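/- Let $X$ be a (real or complex) Hilbert space and let $T>0$. For each $t\in[0,T]$ let $(\cdot,\cdot)_t$ be an inner product on $X$ whose norm $\|\cdot\|_t$ is equivalent to the norm of $X$, and suppose that there is $c>0$ such that, for every $u\in X$, the function $t\mapsto (u,u)_t$ is differentiable on $[0,T]$ with $$\frac{d}{dt}(u,u)_t\le 2c\,(u,u)_t\qquad\text{for all } t\in[0,T].$$ For each $t\in[0,T]$ let $A(t)$ be a single-valued (in general nonlinear) operator in $X$ with the following properties. (i) There is $\omega\ge 0$, independent of $t$, such that for every $t\in[0,T]$ the operator $A(t)+\omega\mathbb{I}$ is maximal monotone for $(\cdot,\cdot)_t$, i.e. its graph $G_t=\{(u,A(t)u+\omega u): u\in D(A(t))\}$ satisfies $\Re\,(y_1-y_2,x_1-x_2)_t\ge 0$ for all $(x_1,y_1),(x_2,y_2)\in G_t$, and no strictly larger subset of $X\times X$ has this property. (ii) The domain $D(A(t))=D$ is independent of $t\in[0,T]$. (iii) There is $L>0$ such that $$\|A(t)u-A(s)u\|_0\le L\,|t-s|\,\bigl(1+\|u\|_0+\|A(s)u\|_0\bigr)\qquad\text{for all } u\in D,\ s,t\in[0,T].$$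 Then for every $a\in D$ the Cauchy problem $$\frac{du}{dt}(t)+A(t)u(t)=0\quad (0\le t\le T),\qquad u(0)=a,$$ has a unique solution $u\in C([0,T];X)$, in the following sense. There is a Lipschitz continuous function $u:[0,T]\to X$ with $u(0)=a$ and $u(t)\in D$ for all $t\in[0,T]$, and a countable set $N\subset[0,T]$ such that, for every $t\in[0,T]\setminus N$, the strong derivative $\frac{du}{dt}(t)$ (one-sided at $t=0$ and $t=T$) exists and equals $-A(t)u(t)$, and the map $s\mapsto -A(s)u(s)$, $[0,T]\to X$, is continuous at $t$. Moreover, every $v\in C([0,T];X)$ with $v(0)=a$, with $v(t)\in D$ for all $t\in[0,T]$, and with strong derivative $\frac{dv}{dt}(t)=-A(t)v(t)$ at all but countably many $t\in[0,T]$ coincides with $u$ on $[0,T]$. -/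

import Mathlib

/-- The norm associated with an inner product `I` on `X` (not necessarily the one that `X` is
equipped with). -/
noncomputable def ipNorm {𝕜 X : Type*} [RCLike 𝕜] [AddCommGroup X] [Module 𝕜 X]
    (I : InnerProductSpace.Core 𝕜 X) (u : X) : ℝ :=
  √(RCLike.re (I.inner u u))

/-- The norm of the inner product `I` is equivalent to the given norm of `X`. -/
def IsEquivalentIP {𝕜 X : Type*} [RCLike 𝕜] [NormedAddCommGroup X] [NormedSpace 𝕜 X]
    (I : InnerProductSpace.Core 𝕜 X) : Prop :=
  ∃ m M : ℝ, 0 < m ∧ ∀ u : X, m * ‖u‖ ≤ ipNorm I u ∧ ipNorm I u ≤ M * ‖u‖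

/-- Monotonicity, for the inner product `I`, of a possibly multivalued operator given by
its graph `G`: `Re (y₁ - y₂, x₁ - x₂) ≥ 0` for all `(x₁, y₁), (x₂, y₂) ∈ G`. -/
def IsMonotoneOperator {𝕜 X : Type*} [RCLike 𝕜] [AddCommGroup X] [Module 𝕜 X]
    (I : InnerProductSpace.Core 𝕜 X) (G : Set (X × X)) : Prop :=
  ∀ p ∈ G, ∀ q ∈ G, 0 ≤ RCLike.re (I.inner (p.2 - q.2) (p.1 - q.1))

/-- A maximal monotone operator: a monotone graph with no proper monotone extension. -/
def IsMaximalMonotoneOperator {𝕜 X : Type*} [RCLike 𝕜] [AddCommGroup X] [Module 𝕜 X]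
    (I : InnerProductSpace.Core 𝕜 X) (G : Set (X × X)) : Prop :=
  Maximal (IsMonotoneOperator I) G

/-- `B + ω` is maximal monotone for the inner product `I`, where `B` is the single-valued
operator with domain `D` (its values outside `D` are irrelevant). -/
def IsMaximalQuasiMonotone {𝕜 X : Type*} [RCLike 𝕜] [AddCommGroup X] [Module 𝕜 X]
    (I : InnerProductSpace.Core 𝕜 X) (ω : ℝ) (D : Set X) (B : X → X) : Prop :=
  IsMaximalMonotoneOperator I (Set.graphOn (fun u => B u + (ω : 𝕜) • u) D)

/-- `u' + A(t) u = 0` on `[0, T]`, `u(0) = a`: `u` is continuous, takes its values in `D`, and has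
the strong derivative `-A(t) u(t)` at all but countably many `t` (one-sided at `0` and `T`). -/
structure IsCauchySolution {X : Type*} [NormedAddCommGroup X] [NormedSpace ℝ X]
    (T : ℝ) (D : Set X) (A : ℝ → X → X) (a : X) (u : ℝ → X) : Prop where
  continuousOn : ContinuousOn u (Set.Icc 0 T)
  initial : u 0 = a
  mem_domain : ∀ t ∈ Set.Icc 0 T, u t ∈ D
  equation : ∃ N : Set ℝ, N.Countable ∧
    ∀ t ∈ Set.Icc 0 T \ N, HasDerivWithinAt u (-(A t (u t))) (Set.Icc 0 T) t

open Set Filter Topology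

/-! The solution is the limit of implicit Euler approximations, and everything rests on one
quantity: the state size `1 + ‖u‖_t + ‖A(t)u‖_t`. An implicit step `z + δ A(t)z = y` is solvable by
Minty's theorem, and multiplies the state size by at most `exp (C δ)` with `C = 1 + 2ω + c + Λ`, `Λ`
being the Lipschitz constant of `A` in time for this size (`stateSize_euler_step_le`). So the linear
interpolants are uniformly Lipschitz.

Quasi-monotonicity bounds the growth rate of the squared distance of two interpolants by `2 (c + ω)`
times itself plus an error of the order of the steps (`exists_sq_dist_le`). Hence they converge to
some `u`. The estimate holds from any starting time, so approximations restarted at `(s, u s)`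
converge to `u` as well.

A maximal monotone operator is demiclosed: values bounded along a convergent sequence force the
limit into the domain, with the same asymptotic bound. With the restart this shows that `exp (-C t)`
times the state size of `u t` is nonincreasing. If moreover the norms of the values do not exceed
that of the limit value, the values converge strongly. Near a restart time `s` the size bound
supplies exactly this, so `u` has the right derivative `-A(s)u(s)` at every `s < T`. At a continuity
point of the nonincreasing function, `s ↦ A(s)u(s)` is continuous, and there the right derivative
becomes a derivative. A monotone function has only countably many discontinuities.

Uniqueness is the same distance estimate with no error term, combined with a Dini derivative lemma
that tolerates a countable exceptional set. -/

lemma cauchySeq_of_sq_norm_le {X : Type*} [NormedAddCommGroup X] {x : ℕ → X} {C : ℝ}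
    (h : ∀ n m, ‖x n - x m‖ ^ 2 ≤ C * (1 / ((n : ℝ) + 1) + 1 / ((m : ℝ) + 1))) : CauchySeq x := by
  rw [Metric.cauchySeq_iff]
  intro ε hε
  have h0 : Tendsto (fun n : ℕ => 2 * (|C| * (1 / ((n : ℝ) + 1)))) atTop (𝓝 0) := by
    simpa using (tendsto_one_div_add_atTop_nhds_zero_nat (𝕜 := ℝ)).const_mul |C| |>.const_mul 2
  obtain ⟨N, hN⟩ := (h0.eventually_lt_const (show 0 < ε ^ 2 by positivity)).exists
  refine ⟨N, fun n hn m hm => ?_⟩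
  rw [dist_eq_norm]
  refine lt_of_pow_lt_pow_left₀ 2 hε.le ((h n m).trans_lt (lt_of_le_of_lt ?_ hN))
  have h1 : (1 : ℝ) / ((n : ℝ) + 1) ≤ 1 / ((N : ℝ) + 1) :=
    one_div_le_one_div_of_le (by positivity) (by gcongr)
  have h2 : (1 : ℝ) / ((m : ℝ) + 1) ≤ 1 / ((N : ℝ) + 1) :=
    one_div_le_one_div_of_le (by positivity) (by gcongr)
  have h3 : C * (1 / ((n : ℝ) + 1) + 1 / ((m : ℝ) + 1))
      ≤ |C| * (1 / ((n : ℝ) + 1) + 1 / ((m : ℝ) + 1)) :=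
    mul_le_mul_of_nonneg_right (le_abs_self C) (by positivity)
  have h4 := mul_le_mul_of_nonneg_left (add_le_add h1 h2) (abs_nonneg C)
  linarith

/-! ### Real bilinear forms with equivalent norm. -/

section Forms

variable {X : Type*} [NormedAddCommGroup X] [NormedSpace ℝ X]

/-- The norm of a positive bilinear form. -/
noncomputable def formNorm (b : X →L[ℝ] X →L[ℝ] ℝ) (u : X) : ℝ := √(b u u)

/-- A symmetric bilinear form whose norm is equivalent, with constant `κ`, to the norm of `X`. -/
structure IsCoerciveForm (κ : ℝ) (b : X →L[ℝ] X →L[ℝ] ℝ) : Prop where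
  pos : 0 < κ
  symm : ∀ u v, b u v = b v u
  nonneg : ∀ u, 0 ≤ b u u
  norm_le : ∀ u, ‖u‖ ≤ κ * formNorm b u
  le_norm : ∀ u, formNorm b u ≤ κ * ‖u‖

lemma tendsto_form_apply {ι : Type*} {l : Filter ι} {B : ι → X →L[ℝ] X →L[ℝ] ℝ}
    {b : X →L[ℝ] X →L[ℝ] ℝ} {u v : ι → X} {x y : X} (hB : Tendsto B l (𝓝 b))
    (hu : Tendsto u l (𝓝 x)) (hv : Tendsto v l (𝓝 y)) :
    Tendsto (fun i => B i (u i) (v i)) l (𝓝 (b x y)) :=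
  ((isBoundedBilinearMap_apply (𝕜 := ℝ) (E := X) (F := ℝ)).continuous.tendsto (b x, y)).comp
    ((((isBoundedBilinearMap_apply (𝕜 := ℝ) (E := X) (F := X →L[ℝ] ℝ)).continuous.tendsto
      (b, x)).comp (hB.prodMk_nhds hu)).prodMk_nhds hv)

lemma formNorm_nonneg (b : X →L[ℝ] X →L[ℝ] ℝ) (u : X) : 0 ≤ formNorm b u := Real.sqrt_nonneg _

namespace IsCoerciveForm

variable {κ : ℝ} {b : X →L[ℝ] X →L[ℝ] ℝ}

lemma sq_formNorm (hb : IsCoerciveForm κ b) (u : X) : formNorm b u ^ 2 = b u u :=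
  Real.sq_sqrt (hb.nonneg u)

lemma sq_norm_le (hb : IsCoerciveForm κ b) (u : X) : ‖u‖ ^ 2 ≤ κ ^ 2 * b u u := by
  rw [← hb.sq_formNorm, ← mul_pow]
  exact pow_le_pow_left₀ (norm_nonneg _) (hb.norm_le u) 2

lemma apply_le (hb : IsCoerciveForm κ b) (u v : X) : b u v ≤ formNorm b u * formNorm b v := by
  have h : ∀ s : ℝ, 0 ≤ b v v * (s * s) + 2 * b u v * s + b u u := fun s => by
    have := hb.nonneg (u + s • v)
    simp only [map_add, map_smul, add_apply, smul_apply, smul_eq_mul, hb.symm v u] at this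
    linarith
  have := discrim_le_zero h
  rw [discrim] at this
  have h2 : b u v ^ 2 ≤ (formNorm b u * formNorm b v) ^ 2 := by
    rw [mul_pow, hb.sq_formNorm, hb.sq_formNorm]; linarith
  exact (le_abs_self _).trans
    (abs_le_of_sq_le_sq h2 (mul_nonneg (formNorm_nonneg _ _) (formNorm_nonneg _ _)))

lemma formNorm_neg (b : X →L[ℝ] X →L[ℝ] ℝ) (u : X) : formNorm b (-u) = formNorm b u := by
  simp [formNorm]

lemma neg_le_apply (hb : IsCoerciveForm κ b) (u v : X) :
    -(formNorm b u * formNorm b v) ≤ b u v := by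
  have := hb.apply_le (-u) v
  rw [formNorm_neg] at this
  simp at this
  linarith

lemma formNorm_add_le (hb : IsCoerciveForm κ b) (u v : X) :
    formNorm b (u + v) ≤ formNorm b u + formNorm b v := by
  refine abs_le_of_sq_le_sq' ?_ (add_nonneg (formNorm_nonneg _ _) (formNorm_nonneg _ _)) |>.2
  rw [hb.sq_formNorm, add_sq, hb.sq_formNorm, hb.sq_formNorm]
  have := hb.apply_le u v
  simp only [map_add, add_apply, hb.symm v u]
  linarith

lemma formNorm_sub_le (hb : IsCoerciveForm κ b) (u v : X) :
    formNorm b (u - v) ≤ formNorm b u + formNorm b v := by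
  simpa [sub_eq_add_neg, formNorm_neg] using hb.formNorm_add_le u (-v)

lemma formNorm_smul (b : X →L[ℝ] X →L[ℝ] ℝ) {r : ℝ} (hr : 0 ≤ r) (u : X) :
    formNorm b (r • u) = r * formNorm b u := by
  simp only [formNorm, map_smul, smul_apply, smul_eq_mul, ← mul_assoc]
  rw [Real.sqrt_mul (mul_nonneg hr hr), Real.sqrt_mul_self hr]

end IsCoerciveForm

/-! ### Maximal monotone operators: Minty's theorem and demiclosedness. -/

/-- The single-valued operator `E` with domain `D` is maximal monotone for the form `b`. -/
structure IsMaxMonotone (b : X →L[ℝ] X →L[ℝ] ℝ) (D : Set X) (E : X → X) : Prop where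
  mono : ∀ x ∈ D, ∀ y ∈ D, 0 ≤ b (E x - E y) (x - y)
  maximal : ∀ x y, (∀ z ∈ D, 0 ≤ b (y - E z) (x - z)) → x ∈ D ∧ E x = y

namespace IsMaxMonotone

variable {κ : ℝ} {b : X →L[ℝ] X →L[ℝ] ℝ} {D : Set X} {E : X → X}

lemma add_const (h : IsMaxMonotone b D E) (e : X) : IsMaxMonotone b D (fun x => E x + e) := by
  refine ⟨fun x hx y hy => by simpa using h.mono x hx y hy, fun x y hxy => ?_⟩
  obtain ⟨h1, h2⟩ := h.maximal x (y - e) fun z hz => by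
    have := hxy z hz; rwa [← sub_sub, sub_right_comm] at this
  exact ⟨h1, by rw [h2]; abel⟩

lemma smul (h : IsMaxMonotone b D E) {r : ℝ} (hr : 0 < r) :
    IsMaxMonotone b D (fun x => r • E x) := by
  refine ⟨fun x hx y hy => ?_, fun x y hxy => ?_⟩
  · rw [← smul_sub]
    simpa using mul_nonneg hr.le (h.mono x hx y hy)
  · obtain ⟨h1, h2⟩ := h.maximal x (r⁻¹ • y) fun z hz => by
      have : r⁻¹ • y - E z = r⁻¹ • (y - r • E z) := by
        rw [smul_sub, smul_smul, inv_mul_cancel₀ hr.ne', one_smul]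
      rw [this]
      simpa using mul_nonneg (inv_pos.2 hr).le (hxy z hz)
    exact ⟨h1, by rw [h2, smul_smul, mul_inv_cancel₀ hr.ne', one_smul]⟩

/-- The epigraph of the Fitzpatrick function lies above the duality product. -/
lemma apply_le_of_fitzpatrick_le (hb : IsCoerciveForm κ b) (h : IsMaxMonotone b D E) {x y : X}
    {s : ℝ} (hs : ∀ a ∈ D, b x (E a) + b a y - b a (E a) ≤ s) : b x y ≤ s := by
  by_contra! hlt
  -- If `s < b x y`, the bound makes `(x, y)` monotonically related to the whole graph, hence a
  -- point of it; then `a = x` in the bound gives `b x y ≤ s`.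
  obtain ⟨h1, h2⟩ := h.maximal x y fun z hz => by
    have := hs z hz
    simp only [map_sub, sub_apply, hb.symm y, hb.symm (E z)]
    linarith
  have := hs x h1
  rw [h2] at this
  linarith

/-- The Fitzpatrick function plus half the squared norm attains its minimum. -/
lemma exists_fitzpatrick_min [CompleteSpace X] (hb : IsCoerciveForm κ b)
    (h : IsMaxMonotone b D E) (hD : D.Nonempty) :
    ∃ x y s, (∀ a ∈ D, b x (E a) + b a y - b a (E a) ≤ s) ∧
      ∀ x' y' s', (∀ a ∈ D, b x' (E a) + b a y' - b a (E a) ≤ s') →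
        2 * s + b x x + b y y ≤ 2 * s' + b x' x' + b y' y' := by
  set V : Set ℝ := {v | ∃ x y s, (∀ a ∈ D, b x (E a) + b a y - b a (E a) ≤ s) ∧
    v = 2 * s + b x x + b y y} with hV
  have hne : V.Nonempty := by
    obtain ⟨a₀, ha₀⟩ := hD
    refine ⟨_, a₀, E a₀, b a₀ (E a₀), fun a ha => ?_, rfl⟩
    have := h.mono a₀ ha₀ a ha
    simp only [map_sub, sub_apply, hb.symm (E a₀), hb.symm (E a)] at this
    linarith
  have hbdd : BddBelow V := by
    refine ⟨0, ?_⟩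
    rintro v ⟨x, y, s, hs, rfl⟩
    have h1 := apply_le_of_fitzpatrick_le hb h hs
    have h2 := hb.nonneg (x + y)
    simp only [map_add, add_apply, hb.symm y x] at h2
    linarith
  have hseq : ∀ n : ℕ, ∃ x y s, (∀ a ∈ D, b x (E a) + b a y - b a (E a) ≤ s) ∧
      2 * s + b x x + b y y < sInf V + 1 / ((n : ℝ) + 1) := fun n => by
    obtain ⟨v, ⟨x, y, s, hs, rfl⟩, hv⟩ := exists_lt_of_csInf_lt hne
      (show sInf V < sInf V + 1 / ((n : ℝ) + 1) by linarith [Nat.one_div_pos_of_nat (α := ℝ) (n := n)])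
    exact ⟨x, y, s, hs, hv⟩
  choose x y s hs hv using hseq
  have hlow : ∀ x' y' s', (∀ a ∈ D, b x' (E a) + b a y' - b a (E a) ≤ s') →
      sInf V ≤ 2 * s' + b x' x' + b y' y' :=
    fun x' y' s' hs' => csInf_le hbdd ⟨x', y', s', hs', rfl⟩
  -- The parallelogram identity: the constraint is convex, so the midpoint of two near-minimisers
  -- competes, and its value falls below the mean by a quarter of the squared distance.
  have hpar : ∀ n m, b (x n - x m) (x n - x m) + b (y n - y m) (y n - y m)
      ≤ 2 * (1 / ((n : ℝ) + 1) + 1 / ((m : ℝ) + 1)) := fun n m => by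
    have h1 := hlow ((1 / 2 : ℝ) • (x n + x m)) ((1 / 2 : ℝ) • (y n + y m)) ((s n + s m) / 2)
      fun a ha => by
        have h1 := hs n a ha
        have h2 := hs m a ha
        simp only [map_add, map_smul, add_apply, smul_apply, smul_eq_mul]
        linarith
    have h2 := hv n
    have h3 := hv m
    simp only [map_add, map_smul, add_apply, smul_apply, smul_eq_mul] at h1
    simp only [map_sub, sub_apply]
    linarith
  have hxc : CauchySeq x := cauchySeq_of_sq_norm_le (C := κ ^ 2 * 2) fun n m => by
    have h1 := hb.sq_norm_le (x n - x m)
    have h2 : b (x n - x m) (x n - x m) ≤ _ :=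
      (le_add_of_nonneg_right (hb.nonneg (y n - y m))).trans (hpar n m)
    have h3 := mul_le_mul_of_nonneg_left h2 (sq_nonneg κ)
    linarith
  have hyc : CauchySeq y := cauchySeq_of_sq_norm_le (C := κ ^ 2 * 2) fun n m => by
    have h1 := hb.sq_norm_le (y n - y m)
    have h2 : b (y n - y m) (y n - y m) ≤ _ :=
      (le_add_of_nonneg_left (hb.nonneg (x n - x m))).trans (hpar n m)
    have h3 := mul_le_mul_of_nonneg_left h2 (sq_nonneg κ)
    linarith
  obtain ⟨x₀, hx₀⟩ := cauchySeq_tendsto_of_complete hxc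
  obtain ⟨y₀, hy₀⟩ := cauchySeq_tendsto_of_complete hyc
  have hxx : Tendsto (fun n => b (x n) (x n)) atTop (𝓝 (b x₀ x₀)) :=
    tendsto_form_apply tendsto_const_nhds hx₀ hx₀
  have hyy : Tendsto (fun n => b (y n) (y n)) atTop (𝓝 (b y₀ y₀)) :=
    tendsto_form_apply tendsto_const_nhds hy₀ hy₀
  -- Convergence of `s n` itself is not needed: it lies below a quantity tending to this `s₀`, the
  -- value for which `(x₀, y₀, s₀)` attains the infimum.
  set s₀ : ℝ := (sInf V - b x₀ x₀ - b y₀ y₀) / 2 with hs₀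
  refine ⟨x₀, y₀, s₀, fun a ha => ?_, fun x' y' s' hs' => ?_⟩
  · have hup : Tendsto (fun n : ℕ => (sInf V + 1 / ((n : ℝ) + 1) - b (x n) (x n)
        - b (y n) (y n)) / 2) atTop (𝓝 s₀) := by
      have := tendsto_one_div_add_atTop_nhds_zero_nat (𝕜 := ℝ)
      simpa using (((this.const_add (sInf V)).sub hxx).sub hyy).div_const 2
    have hl : Tendsto (fun n => b (x n) (E a) + b a (y n) - b a (E a)) atTop
        (𝓝 (b x₀ (E a) + b a y₀ - b a (E a))) :=
      ((((b.flip (E a)).continuous.tendsto x₀).comp hx₀).add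
        (((b a).continuous.tendsto y₀).comp hy₀)).sub_const _
    refine le_of_tendsto_of_tendsto' hl hup fun n => (hs n a ha).trans ?_
    have := hv n
    linarith
  · have := hlow x' y' s' hs'
    linarith

/-- **Minty's theorem**, at zero. -/
lemma exists_add_eq_zero [CompleteSpace X] (hb : IsCoerciveForm κ b)
    (h : IsMaxMonotone b D E) (hD : D.Nonempty) : ∃ x ∈ D, x + E x = 0 := by
  obtain ⟨x, y, s, hs, hmin⟩ := exists_fitzpatrick_min hb h hD
  have hxy := apply_le_of_fitzpatrick_le hb h hs
  -- First variation at the minimiser towards the graph point `(a, E a)` with height `b a (E a)`.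
  -- The segment stays in the epigraph: the constraint is convex and holds at `(a, E a)` by
  -- monotonicity.
  have hvar : ∀ a ∈ D, 0 ≤ (b a (E a) - s) + b x (a - x) + b y (E a - y) := fun a ha => by
    have hlim : Tendsto (fun θ : ℝ => 2 * ((b a (E a) - s) + b x (a - x) + b y (E a - y))
        + θ * (b (a - x) (a - x) + b (E a - y) (E a - y))) (𝓝[>] 0)
        (𝓝 (2 * ((b a (E a) - s) + b x (a - x) + b y (E a - y)))) := by
      have : Tendsto (fun θ : ℝ => θ) (𝓝[>] 0) (𝓝 0) := tendsto_nhdsWithin_of_tendsto_nhds tendsto_id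
      simpa using (this.mul_const (b (a - x) (a - x) + b (E a - y) (E a - y))).const_add
        (2 * ((b a (E a) - s) + b x (a - x) + b y (E a - y)))
    have hpos : ∀ᶠ θ : ℝ in 𝓝[>] 0, 0 ≤ 2 * ((b a (E a) - s) + b x (a - x) + b y (E a - y))
        + θ * (b (a - x) (a - x) + b (E a - y) (E a - y)) := by
      filter_upwards [Ioo_mem_nhdsGT (show (0 : ℝ) < 1 by norm_num)] with θ hθ
      have h1 := hmin (x + θ • (a - x)) (y + θ • (E a - y)) (s + θ * (b a (E a) - s))
        fun a' ha' => by
          have h2 := mul_le_mul_of_nonneg_left (hs a' ha') (sub_nonneg.2 hθ.2.le)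
          have h3 := mul_nonneg hθ.1.le (h.mono a ha a' ha')
          simp only [map_sub, sub_apply, hb.symm (E a), hb.symm (E a')] at h3
          simp only [map_add, map_sub, map_smul, add_apply, sub_apply, smul_apply, smul_eq_mul]
          linarith
      have h4 : 0 ≤ θ * (2 * ((b a (E a) - s) + b x (a - x) + b y (E a - y))
          + θ * (b (a - x) (a - x) + b (E a - y) (E a - y))) := by
        simp only [map_add, map_sub, map_smul, add_apply, sub_apply, smul_apply, smul_eq_mul,
          hb.symm a x, hb.symm (E a) y] at h1 ⊢
        linarith
      exact nonneg_of_mul_nonneg_right h4 hθ.1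
    have := ge_of_tendsto hlim hpos
    linarith
  -- With `b x y ≤ s` the variation completes to a square, so `(-y, -x)` is a point of the graph;
  -- then `a = -y` makes the right side vanish and forces `x + y = 0`.
  have hkey : ∀ a ∈ D, b (x + y) (x + y) ≤ b (-x - E a) (-y - a) := fun a ha => by
    have := hvar a ha
    simp only [map_add, map_sub, map_neg, neg_apply, add_apply, sub_apply,
      hb.symm y x, hb.symm (E a)] at this ⊢
    linarith
  obtain ⟨h1, h2⟩ := h.maximal (-y) (-x) fun a ha => (hb.nonneg _).trans (hkey a ha)
  refine ⟨-y, h1, ?_⟩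
  have h3 := hkey _ h1
  rw [h2] at h3
  simp only [sub_self, map_zero] at h3
  have h4 := hb.sq_norm_le (x + y)
  have h5 : ‖x + y‖ ^ 2 ≤ 0 := h4.trans (mul_nonpos_of_nonneg_of_nonpos (sq_nonneg κ) h3)
  have h6 : x + y = 0 := norm_eq_zero.1 (pow_eq_zero_iff two_ne_zero |>.1 (le_antisymm h5 (sq_nonneg _)))
  rw [h2, ← neg_add_rev, h6, neg_zero]

/-- **Minty's theorem**: resolvents are everywhere defined. -/
lemma exists_add_smul_eq [CompleteSpace X] (hb : IsCoerciveForm κ b)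
    (h : IsMaxMonotone b D E) (hD : D.Nonempty) {r : ℝ} (hr : 0 < r) (z : X) :
    ∃ x ∈ D, x + r • E x = z := by
  obtain ⟨x, hx, hx0⟩ := exists_add_eq_zero hb ((h.smul hr).add_const (-z)) hD
  refine ⟨x, hx, ?_⟩
  rw [← add_assoc] at hx0
  exact add_neg_eq_zero.1 hx0

/-- The graph of a maximal monotone operator is closed. -/
lemma mem_of_tendsto (h : IsMaxMonotone b D E) {ι : Type*} {l : Filter ι} [l.NeBot] {u : ι → X}
    {x y : X} (hu : Tendsto u l (𝓝 x)) (hD : ∀ᶠ i in l, u i ∈ D)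
    (hE : Tendsto (fun i => E (u i)) l (𝓝 y)) : x ∈ D ∧ E x = y :=
  h.maximal x y fun z hz => ge_of_tendsto
    (tendsto_form_apply tendsto_const_nhds (hE.sub_const (E z)) (hu.sub_const z))
    (hD.mono fun _ hi => h.mono _ hi z hz)

/-- The distance of a value of `E` to a value of the Yosida approximation. -/
lemma yosida_dist_le (hb : IsCoerciveForm κ b) (h : IsMaxMonotone b D E) {r : ℝ} (hr : 0 < r)
    {x y z : X} (hy : y ∈ D) (hz : z ∈ D) (hx : y + r • E y = x) :
    b (E y) (E y) + b (E y - E z) (E y - E z) ≤ b (E z) (E z) + 2 / r * b (E z - E y) (z - x) := by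
  have h1 := h.mono z hz y hy
  rw [show z - y = z - x + r • E y by rw [← hx]; abel] at h1
  rw [map_add, map_smul, smul_eq_mul] at h1
  have h2 : 0 ≤ 2 / r * (b (E z - E y) (z - x) + r * b (E z - E y) (E y)) :=
    mul_nonneg (by positivity) h1
  rw [mul_add, ← mul_assoc, div_mul_cancel₀ _ hr.ne'] at h2
  simp only [map_sub, sub_apply, hb.symm (E z) (E y)] at h2 ⊢
  linarith

/-- The Yosida approximations grow as the parameter decreases. -/
lemma yosida_dist_le_sub (hb : IsCoerciveForm κ b) (h : IsMaxMonotone b D E) {r s : ℝ}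
    (hs : 0 < s) (hsr : s < r) {x y z : X} (hy : y ∈ D) (hz : z ∈ D) (hx : y + r • E y = x)
    (hx' : z + s • E z = x) :
    b (E y - E z) (E y - E z) ≤ b (E z) (E z) - b (E y) (E y) := by
  have h1 := h.mono y hy z hz
  rw [show y - z = s • E z - r • E y by
    rw [sub_eq_sub_iff_add_eq_add, hx, add_comm, hx']] at h1
  have h2 := hb.nonneg (E y - E z)
  simp only [map_sub, map_smul, sub_apply, smul_eq_mul, hb.symm (E z) (E y)] at h1 h2 ⊢
  have h3 := mul_nonneg hs.le h2
  have h4 : 0 ≤ (r - s) * (b (E y) (E z) - b (E y) (E y)) := by linarith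
  have := nonneg_of_mul_nonneg_right h4 (sub_pos.2 hsr)
  linarith

variable {ι : Type*} {l : Filter ι} [l.NeBot] {u : ι → X} {m : ι → ℝ} {x : X} {M : ℝ}

/-- If `E` is bounded along a sequence converging to `x`, then the Yosida approximations at `x`
converge, and their limit is `E x`. -/
lemma exists_yosida [CompleteSpace X] (hb : IsCoerciveForm κ b) (h : IsMaxMonotone b D E)
    (hu : Tendsto u l (𝓝 x)) (hD : ∀ᶠ i in l, u i ∈ D)
    (hm : ∀ᶠ i in l, b (E (u i)) (E (u i)) ≤ m i) (hM : Tendsto m l (𝓝 M)) :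
    ∃ y : ℕ → X, x ∈ D ∧ Tendsto y atTop (𝓝 (E x)) ∧ (∀ n, b (y n) (y n) ≤ M) ∧
      ∀ n, ∀ ε > 0, ∀ᶠ i in l, b (y n - E (u i)) (y n - E (u i)) ≤ M - b (y n) (y n) + ε := by
  have hne : D.Nonempty := hD.exists.elim fun i hi => ⟨u i, hi⟩
  choose z hzD hz using fun n : ℕ =>
    h.exists_add_smul_eq hb hne (Nat.one_div_pos_of_nat (α := ℝ) (n := n)) x
  -- For fixed `n` the parameter `r` is fixed, so the error term `2 / r * b (E (u i) - E (z n)) (u i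
  -- - x)` tends to zero: the first factor is bounded, the second vanishes in the limit. This
  -- replaces weak compactness.
  have hub : ∀ n, ∀ ε > 0, ∀ᶠ i in l,
      b (E (z n) - E (u i)) (E (z n) - E (u i)) ≤ M - b (E (z n)) (E (z n)) + ε := by
    intro n ε hε
    set r : ℝ := 1 / ((n : ℝ) + 1) with hr
    have hr0 : 0 < r := Nat.one_div_pos_of_nat
    have hlim : Tendsto (fun i => m i + 2 / r * ((√(M + 1) + formNorm b (E (z n)))
        * (κ * ‖u i - x‖))) l (𝓝 M) := by
      have h0 : Tendsto (fun i => ‖u i - x‖) l (𝓝 0) := by simpa using (hu.sub_const x).norm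
      simpa using hM.add (((h0.const_mul κ).const_mul
        (√(M + 1) + formNorm b (E (z n)))).const_mul (2 / r))
    filter_upwards [hD, hm, hM.eventually_lt_const (lt_add_one M),
      hlim.eventually_lt_const (lt_add_of_pos_right M hε)] with i hi hmi hmM hlt
    have h1 := yosida_dist_le hb h hr0 (hzD n) hi (hz n)
    have h2 : formNorm b (E (u i) - E (z n)) ≤ √(M + 1) + formNorm b (E (z n)) :=
      (hb.formNorm_sub_le _ _).trans (by gcongr; exact Real.sqrt_le_sqrt (hmi.trans hmM.le))
    have h3 : 2 / r * b (E (u i) - E (z n)) (u i - x) ≤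
        2 / r * ((√(M + 1) + formNorm b (E (z n))) * (κ * ‖u i - x‖)) := by
      refine mul_le_mul_of_nonneg_left ((hb.apply_le _ _).trans ?_) (by positivity)
      exact mul_le_mul h2 (hb.le_norm _) (formNorm_nonneg _ _)
        (add_nonneg (Real.sqrt_nonneg _) (formNorm_nonneg _ _))
    linarith
  have hle : ∀ n, b (E (z n)) (E (z n)) ≤ M := fun n => le_of_forall_pos_le_add fun ε hε => by
    obtain ⟨i, hi⟩ := (hub n ε hε).exists
    have := hb.nonneg (E (z n) - E (u i))
    linarith
  have hdist : ∀ n k, n ≤ k → b (E (z n) - E (z k)) (E (z n) - E (z k))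
      ≤ b (E (z k)) (E (z k)) - b (E (z n)) (E (z n)) := fun n k hnk => by
    rcases hnk.eq_or_lt with rfl | hlt
    · simp
    · exact yosida_dist_le_sub hb h Nat.one_div_pos_of_nat
        (one_div_lt_one_div_of_lt (by positivity) (by gcongr)) (hzD n) (hzD k) (hz n) (hz k)
  have hmono : Monotone fun n => b (E (z n)) (E (z n)) := fun n k hnk =>
    sub_nonneg.1 ((hb.nonneg _).trans (hdist n k hnk))
  have hreal : CauchySeq fun n => b (E (z n)) (E (z n)) :=
    (tendsto_atTop_ciSup hmono ⟨M, by rintro _ ⟨n, rfl⟩; exact hle n⟩).cauchySeq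
  -- The squared norms increase and are bounded by `M`, and their increments dominate the squared
  -- distances.
  have hcauchy : CauchySeq fun n => E (z n) := by
    have hκ := hb.pos
    rw [Metric.cauchySeq_iff'] at hreal ⊢
    intro ε hε
    obtain ⟨N, hN⟩ := hreal (ε ^ 2 / κ ^ 2) (by positivity)
    refine ⟨N, fun n hn => ?_⟩
    have h1 := hN n hn
    rw [lt_div_iff₀ (by positivity), Real.dist_eq, abs_of_nonneg (sub_nonneg.2 (hmono hn))] at h1
    have h2 := mul_le_mul_of_nonneg_left (hdist N n hn) (sq_nonneg κ)
    rw [dist_comm, dist_eq_norm]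
    refine lt_of_pow_lt_pow_left₀ 2 hε.le ((hb.sq_norm_le _).trans_lt ?_)
    linarith
  obtain ⟨y, hy⟩ := cauchySeq_tendsto_of_complete hcauchy
  have hzx : Tendsto z atTop (𝓝 x) := by
    have h1 : Tendsto (fun n : ℕ => x - (1 / ((n : ℝ) + 1)) • E (z n)) atTop (𝓝 x) := by
      simpa using ((tendsto_one_div_add_atTop_nhds_zero_nat (𝕜 := ℝ)).smul hy).const_sub x
    exact h1.congr fun n => sub_eq_of_eq_add (hz n).symm
  obtain ⟨hx, rfl⟩ := h.mem_of_tendsto hzx (Eventually.of_forall hzD) hy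
  exact ⟨fun n => E (z n), hx, hy, hle, hub⟩

/-- Demiclosedness, with the bound for the limit. -/
lemma mem_and_le_of_tendsto [CompleteSpace X] (hb : IsCoerciveForm κ b)
    (h : IsMaxMonotone b D E) (hu : Tendsto u l (𝓝 x)) (hD : ∀ᶠ i in l, u i ∈ D)
    (hm : ∀ᶠ i in l, b (E (u i)) (E (u i)) ≤ m i) (hM : Tendsto m l (𝓝 M)) :
    x ∈ D ∧ b (E x) (E x) ≤ M := by
  obtain ⟨y, hx, hy, hle, -⟩ := exists_yosida hb h hu hD hm hM
  exact ⟨hx, le_of_tendsto' (tendsto_form_apply tendsto_const_nhds hy hy) hle⟩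

/-- Strong convergence of the values of `E` if their norms do not exceed that of the limit. -/
lemma tendsto_of_le [CompleteSpace X] (hb : IsCoerciveForm κ b)
    (h : IsMaxMonotone b D E) (hu : Tendsto u l (𝓝 x)) (hD : ∀ᶠ i in l, u i ∈ D)
    (hm : ∀ᶠ i in l, b (E (u i)) (E (u i)) ≤ m i) (hM : Tendsto m l (𝓝 (b (E x) (E x)))) :
    Tendsto (fun i => E (u i)) l (𝓝 (E x)) := by
  obtain ⟨y, hx, hy, hle, hub⟩ := exists_yosida hb h hu hD hm hM
  have hκ := hb.pos
  rw [Metric.tendsto_nhds]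
  intro ε hε
  have hyy := tendsto_form_apply (tendsto_const_nhds (x := b)) hy hy
  -- One `η` pays for the gap between `b (y n) (y n)` and its limit, the other for the slack in
  -- `hub`; `κ` converts to the norm of `X`.
  set η : ℝ := (ε / 2) ^ 2 / κ ^ 2 / 2 with hη
  have hη0 : 0 < η := by positivity
  obtain ⟨n, hn1, hn2⟩ := ((hyy.eventually_const_lt (sub_lt_self _ hη0)).and
    (Metric.tendsto_nhds.1 hy (ε / 2) (half_pos hε))).exists
  filter_upwards [hub n η hη0] with i hi
  have h1 : ‖y n - E (u i)‖ < ε / 2 := by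
    refine lt_of_pow_lt_pow_left₀ 2 (half_pos hε).le ((hb.sq_norm_le _).trans_lt ?_)
    have h2 : b (y n - E (u i)) (y n - E (u i)) < (ε / 2) ^ 2 / κ ^ 2 := by linarith
    rw [lt_div_iff₀ (by positivity)] at h2
    linarith
  calc dist (E (u i)) (E x) ≤ dist (y n) (E (u i)) + dist (y n) (E x) := dist_triangle_left _ _ _
    _ < ε / 2 + ε / 2 := add_lt_add (by rwa [dist_eq_norm]) hn2
    _ = ε := add_halves ε

end IsMaxMonotone

/-! ### A Dini derivative inequality off a countable set. -/

/-- A function whose upper right Dini derivative is at most `E` off a countable set grows at most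
by `E` times the length of the interval. -/
lemma sub_le_of_eventually_slope_le {q : ℝ → ℝ} {a b E : ℝ} {N : Set ℝ} (hab : a ≤ b)
    (hq : ContinuousOn q (Icc a b)) (hN : N.Countable)
    (h : ∀ r ∈ Ico a b, r ∉ N → ∀ η > 0, ∀ᶠ z in 𝓝[>] r, q z - q r ≤ (E + η) * (z - r)) :
    q b ≤ q a + E * (b - a) := by
  obtain ⟨f, hf⟩ : ∃ f : ℕ → ℝ, N ⊆ range f := by
    rcases N.eq_empty_or_nonempty with rfl | hne
    · exact ⟨fun _ => 0, empty_subset _⟩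
    · obtain ⟨f, rfl⟩ := hN.exists_eq_range hne
      exact ⟨f, Subset.rfl⟩
  set σ : ℝ → ℝ := fun t => ∑' n, if f n < t then (1 / 2 : ℝ) ^ n else 0 with hσ
  have hsum : ∀ t, Summable fun n => if f n < t then (1 / 2 : ℝ) ^ n else 0 := fun t =>
    summable_geometric_two.of_nonneg_of_le (fun n => by split_ifs <;> positivity)
      fun n => by split_ifs <;> first | exact le_rfl | positivity
  have hσ0 : ∀ t, 0 ≤ σ t := fun t => tsum_nonneg fun n => by split_ifs <;> positivity
  have hσ2 : ∀ t, σ t ≤ 2 := fun t => by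
    rw [← tsum_geometric_two]
    exact (hsum t).tsum_le_tsum (fun n => by split_ifs <;> first | exact le_rfl | positivity)
      summable_geometric_two
  have hmono : Monotone σ := fun s t hst => (hsum s).tsum_le_tsum (fun n => by
    by_cases h1 : f n < s
    · rw [if_pos h1, if_pos (h1.trans_le hst)]
    · rw [if_neg h1]; split_ifs <;> positivity) (hsum t)
  have hjump : ∀ n t, f n < t → σ (f n) + (1 / 2 : ℝ) ^ n ≤ σ t := fun n t ht => by
    have h1 : HasSum (fun k => (if f k < f n then (1 / 2 : ℝ) ^ k else 0)
        + if k = n then (1 / 2 : ℝ) ^ n else 0) (σ (f n) + (1 / 2 : ℝ) ^ n) :=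
      (hsum (f n)).hasSum.add (hasSum_ite_eq n _)
    refine hasSum_le (fun k => ?_) h1 (hsum t).hasSum
    by_cases hk : k = n
    · subst hk
      simp [ht]
    · by_cases h2 : f k < f n
      · simp [hk, h2, h2.trans ht]
      · simp only [h2, hk, if_false, add_zero]
        split_ifs <;> positivity
  suffices hmain : ∀ ε > 0, q b ≤ q a + (E + ε) * (b - a) + ε * 2 by
    have hlim : Tendsto (fun ε : ℝ => q a + (E + ε) * (b - a) + ε * 2) (𝓝[>] 0)
        (𝓝 (q a + (E + 0) * (b - a) + 0 * 2)) := by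
      refine tendsto_nhdsWithin_of_tendsto_nhds ?_
      exact Continuous.tendsto (by fun_prop) 0
    have := ge_of_tendsto hlim (eventually_mem_nhdsWithin.mono fun ε hε => hmain ε hε)
    simpa using this
  intro ε hε
  set R : ℝ → ℝ := fun t => q a + (E + ε) * (t - a) + ε * σ t with hR
  set S : Set ℝ := {t | ∀ s ∈ Icc a t, q s ≤ R s} with hS
  have hclosed : IsClosed (S ∩ Icc a b) := by
    rw [← isSeqClosed_iff_isClosed]
    intro x t hx hxt
    have ht : t ∈ Icc a b := isClosed_Icc.mem_of_tendsto hxt (Eventually.of_forall fun n => (hx n).2)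
    refine ⟨fun s hs => ?_, ht⟩
    by_cases hex : ∃ n, s ≤ x n
    · obtain ⟨n, hn⟩ := hex
      exact (hx n).1 s ⟨hs.1, hn⟩
    · push Not at hex
      -- Only the endpoint is new, approached from the left; there `σ (x n) ≤ σ s` by monotonicity,
      -- so the jumps do no harm.
      have hst : s = t := le_antisymm hs.2 (le_of_tendsto' hxt fun n => (hex n).le)
      subst hst
      have h1 : Tendsto (fun n => q (x n)) atTop (𝓝 (q s)) :=
        (hq s ht).tendsto.comp (tendsto_nhdsWithin_iff.2
          ⟨hxt, Eventually.of_forall fun n => (hx n).2⟩)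
      have h2 : Tendsto (fun n => q a + (E + ε) * (x n - a) + ε * σ s) atTop (𝓝 (R s)) :=
        (((hxt.sub_const a).const_mul (E + ε)).const_add (q a)).add_const _
      refine le_of_tendsto_of_tendsto' h1 h2 fun n => ((hx n).1 (x n) ⟨(hx n).2.1, le_rfl⟩).trans ?_
      have := mul_le_mul_of_nonneg_left (hmono (hex n).le) hε.le
      simp only [hR]
      linarith
  have haS : a ∈ S := fun s hs => by
    obtain rfl : s = a := le_antisymm hs.2 hs.1
    have := mul_nonneg hε.le (hσ0 s)
    simp only [hR]
    linarith
  have hsub := hclosed.Icc_subset_of_forall_exists_gt haS fun t ht y hy => by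
    have hev : ∀ᶠ z in 𝓝[>] t, q z ≤ R z := by
      have hqt := ht.1 t ⟨ht.2.1, le_rfl⟩
      by_cases htN : t ∈ N
      · obtain ⟨n, rfl⟩ := hf htN
        have h1 : Tendsto (fun z => q z - (E + ε) * (z - f n)) (𝓝[>] f n)
            (𝓝 (q (f n) - (E + ε) * (f n - f n))) := by
          have h2 : Tendsto q (𝓝[>] f n) (𝓝 (q (f n))) :=
            ((hq _ ⟨ht.2.1, ht.2.2.le⟩).mono_of_mem_nhdsWithin
              (mem_of_superset (Ioo_mem_nhdsGT ht.2.2) fun z hz =>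
                ⟨ht.2.1.trans hz.1.le, hz.2.le⟩)).tendsto
          refine h2.sub (tendsto_nhdsWithin_of_tendsto_nhds ?_)
          exact Continuous.tendsto (by fun_prop) (f n)
        have h3 : q (f n) - (E + ε) * (f n - f n) < q (f n) + ε * (1 / 2 : ℝ) ^ n := by
          have : 0 < ε * (1 / 2 : ℝ) ^ n := by positivity
          simpa using this
        filter_upwards [h1.eventually_lt_const h3, eventually_mem_nhdsWithin] with z hz hzt
        have h4 := mul_le_mul_of_nonneg_left (hjump n z hzt) hε.le
        simp only [hR] at hqt ⊢
        linarith
      · filter_upwards [h t ht.2 htN ε hε, eventually_mem_nhdsWithin] with z hz hzt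
        have h4 := mul_le_mul_of_nonneg_left (hmono (le_of_lt hzt)) hε.le
        simp only [hR] at hqt ⊢
        linarith
    obtain ⟨u, hu, hu2⟩ := mem_nhdsGT_iff_exists_Ioo_subset.1 hev
    have hmin : t < min u y := lt_min hu hy
    obtain ⟨z, hz1, hz2⟩ := exists_between hmin
    refine ⟨z, fun s hs => ?_, hz1, hz2.le.trans (min_le_right _ _)⟩
    rcases le_or_gt s t with hst | hst
    · exact ht.1 s ⟨hs.1, hst⟩
    · exact hu2 ⟨hst, hs.2.trans_lt (hz2.trans_le (min_le_left _ _))⟩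
  have := hsub (right_mem_Icc.2 hab) b (right_mem_Icc.2 hab)
  have h2 := mul_le_mul_of_nonneg_left (hσ2 b) hε.le
  simp only [hR] at this
  linarith

/-! ### The evolution family and growth of the state size. -/

/-- A quantity controlling `u` and `A t u` in the norm of the form `B t`. -/
noncomputable def stateSize (B : ℝ → X →L[ℝ] X →L[ℝ] ℝ) (A : ℝ → X → X) (t : ℝ) (u : X) : ℝ :=
  1 + formNorm (B t) u + formNorm (B t) (A t u)

/-- Operators `A t` with common domain `D`, depending on `t` in a Lipschitz way, such that
`A t + ω` is maximal monotone for the form `B t`. -/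
structure IsEvolutionFamily (T c ω κ Λ : ℝ) (B : ℝ → X →L[ℝ] X →L[ℝ] ℝ) (D : Set X)
    (A : ℝ → X → X) : Prop where
  c_nonneg : 0 ≤ c
  omega_nonneg : 0 ≤ ω
  lip_nonneg : 0 ≤ Λ
  coercive : ∀ t ∈ Icc 0 T, IsCoerciveForm κ (B t)
  growth : ∀ s ∈ Icc 0 T, ∀ t ∈ Icc 0 T, s ≤ t → ∀ u,
    B t u u ≤ Real.exp (2 * c * (t - s)) * B s u u
  cont : ContinuousOn B (Icc 0 T)
  maxMono : ∀ t ∈ Icc 0 T, IsMaxMonotone (B t) D (fun x => A t x + ω • x)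
  lip : ∀ r ∈ Icc 0 T, ∀ s ∈ Icc 0 T, ∀ t ∈ Icc 0 T, ∀ u ∈ D,
    formNorm (B r) (A t u - A s u) ≤ Λ * |t - s| * stateSize B A s u

lemma one_le_stateSize (B : ℝ → X →L[ℝ] X →L[ℝ] ℝ) (A : ℝ → X → X) (t : ℝ) (u : X) :
    1 ≤ stateSize B A t u := by
  have := formNorm_nonneg (B t) u
  have := formNorm_nonneg (B t) (A t u)
  unfold stateSize
  linarith

lemma formNorm_le_stateSize (B : ℝ → X →L[ℝ] X →L[ℝ] ℝ) (A : ℝ → X → X) (t : ℝ) (u : X) :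
    formNorm (B t) u ≤ stateSize B A t u := by
  have := formNorm_nonneg (B t) (A t u)
  unfold stateSize
  linarith

lemma formNorm_apply_le_stateSize (B : ℝ → X →L[ℝ] X →L[ℝ] ℝ) (A : ℝ → X → X) (t : ℝ) (u : X) :
    formNorm (B t) (A t u) ≤ stateSize B A t u := by
  have := formNorm_nonneg (B t) u
  unfold stateSize
  linarith

/-- Comparison of the norms of two forms. -/
lemma formNorm_le_add {κ κ' : ℝ} {b b' : X →L[ℝ] X →L[ℝ] ℝ} (hb : IsCoerciveForm κ b)
    (hb' : IsCoerciveForm κ' b') (v : X) :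
    formNorm b v ≤ formNorm b' v + √‖b - b'‖ * ‖v‖ := by
  have h0 : 0 ≤ √‖b - b'‖ * ‖v‖ := by positivity
  refine (abs_le_of_sq_le_sq' ?_ (add_nonneg (formNorm_nonneg _ _) h0)).2
  have h1 : b v v - b' v v ≤ ‖b - b'‖ * ‖v‖ * ‖v‖ :=
    (le_abs_self _).trans ((b - b').le_opNorm₂ v v)
  rw [add_sq, hb.sq_formNorm, hb'.sq_formNorm, mul_pow,
    Real.sq_sqrt (norm_nonneg (b - b'))]
  have := mul_nonneg (formNorm_nonneg b' v) h0
  nlinarith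

namespace IsEvolutionFamily

variable {T c ω κ Λ : ℝ} {B : ℝ → X →L[ℝ] X →L[ℝ] ℝ} {D : Set X} {A : ℝ → X → X}

lemma formNorm_growth (h : IsEvolutionFamily T c ω κ Λ B D A) {s t : ℝ} (hs : s ∈ Icc 0 T)
    (ht : t ∈ Icc 0 T) (hst : s ≤ t) (u : X) :
    formNorm (B t) u ≤ Real.exp (c * (t - s)) * formNorm (B s) u := by
  refine (abs_le_of_sq_le_sq' ?_ (mul_nonneg (Real.exp_nonneg _) (formNorm_nonneg _ _))).2
  rw [mul_pow, (h.coercive t ht).sq_formNorm, (h.coercive s hs).sq_formNorm, ← Real.exp_nat_mul]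
  have := h.growth s hs t ht hst u
  rwa [show ((2 : ℕ) : ℝ) * (c * (t - s)) = 2 * c * (t - s) by push_cast; ring]

lemma quasi_monotone (h : IsEvolutionFamily T c ω κ Λ B D A) {t : ℝ} (ht : t ∈ Icc 0 T)
    {u v : X} (hu : u ∈ D) (hv : v ∈ D) :
    -(ω * B t (u - v) (u - v)) ≤ B t (A t u - A t v) (u - v) := by
  have h1 := (h.maxMono t ht).mono u hu v hv
  rw [add_sub_add_comm, ← smul_sub, map_add, add_apply, map_smul, smul_apply, smul_eq_mul] at h1
  linarith

/-- The implicit Euler step. -/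
lemma exists_euler_step [CompleteSpace X] (h : IsEvolutionFamily T c ω κ Λ B D A)
    (hD : D.Nonempty) {t δ : ℝ} (ht : t ∈ Icc 0 T) (hδ : 0 < δ) (hδω : δ * ω ≤ 1 / 2) (y : X) :
    ∃ z ∈ D, z + δ • A t z = y := by
  have h1 : 0 < 1 - δ * ω := by linarith
  obtain ⟨z, hz, hzy⟩ := (h.maxMono t ht).exists_add_smul_eq (h.coercive t ht) hD
    (div_pos hδ h1) ((1 - δ * ω)⁻¹ • y)
  refine ⟨z, hz, ?_⟩
  have h2 := congrArg (fun w => (1 - δ * ω) • w) hzy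
  have h3 : (1 - δ * ω) * (δ / (1 - δ * ω) * ω) = δ * ω := by
    rw [← mul_assoc, mul_div_cancel₀ _ h1.ne']
  simp only [smul_add, smul_smul, mul_inv_cancel₀ h1.ne', mul_div_cancel₀ _ h1.ne', one_smul] at h2
  rw [← h2, h3, sub_smul, one_smul]
  abel

/-- Growth of the state size in an implicit Euler step. -/
lemma stateSize_euler_step_le (h : IsEvolutionFamily T c ω κ Λ B D A) {s t : ℝ}
    (hs : s ∈ Icc 0 T) (ht : t ∈ Icc 0 T) (hst : s < t) (hω : (t - s) * ω ≤ 1 / 2)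
    {y z : X} (hy : y ∈ D) (hz : z ∈ D) (hzy : z + (t - s) • A t z = y) :
    stateSize B A t z ≤ Real.exp ((1 + 2 * ω + c + Λ) * (t - s)) * stateSize B A s y := by
  set δ := t - s with hδ
  have hδ0 : 0 < δ := sub_pos.2 hst
  have hω0 := h.omega_nonneg
  have hb := h.coercive t ht
  set v := A t z with hv
  have hv0 := formNorm_nonneg (B t) v
  -- Quasi-monotonicity at time `t` for `z` and `y`, whose difference is `-δ v`.
  have h1 : (1 - δ * ω) * formNorm (B t) v ≤ formNorm (B t) (A t y) := by
    have h2 := h.quasi_monotone ht hz hy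
    rw [show z - y = -(δ • v) by rw [← hzy]; abel, ← hv] at h2
    simp only [map_neg, map_smul, neg_apply, smul_apply, smul_eq_mul, map_sub, sub_apply] at h2
    have h3 : 0 ≤ δ * (B t (A t y) v - (1 - δ * ω) * B t v v) := by linarith
    have h4 := nonneg_of_mul_nonneg_right h3 hδ0
    have h5 := hb.apply_le (A t y) v
    rw [← hb.sq_formNorm] at h4
    rcases hv0.eq_or_lt with h6 | h6
    · rw [← h6, mul_zero]; exact formNorm_nonneg _ _
    · refine le_of_mul_le_mul_right ?_ h6
      linarith
  have h2 : formNorm (B t) (A t y) ≤ Real.exp (c * δ) * formNorm (B s) (A s y)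
      + Λ * δ * stateSize B A s y := by
    have h3 := hb.formNorm_add_le (A s y) (A t y - A s y)
    rw [add_sub_cancel] at h3
    have h4 := h.lip t ht s hs t ht y hy
    rw [← hδ, abs_of_pos hδ0] at h4
    have h5 := h.formNorm_growth hs ht hst.le (A s y)
    rw [← hδ] at h5
    linarith
  have h3 : formNorm (B t) z ≤ Real.exp (c * δ) * formNorm (B s) y + δ * formNorm (B t) v := by
    have h4 := hb.formNorm_sub_le y (δ • v)
    rw [IsCoerciveForm.formNorm_smul _ hδ0.le, ← hzy, add_sub_cancel_right, hzy] at h4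
    have h5 := h.formNorm_growth hs ht hst.le y
    rw [← hδ] at h5
    linarith
  -- The four parts of the rate: `2 * ω` from `1 / (1 - δ * ω)`, where `δ * ω ≤ 1 / 2` is used; `1`
  -- from the term `δ * ‖v‖` in the norm of `z`; `c` from the change of norm; `Λ` from the change of
  -- the operator.
  have he1 : 1 + 2 * ω * δ ≤ Real.exp (2 * ω * δ) := by
    have := Real.add_one_le_exp (2 * ω * δ); linarith
  have he2 : 1 + δ ≤ Real.exp δ := by have := Real.add_one_le_exp δ; linarith
  have he3 : 1 + Λ * δ ≤ Real.exp (Λ * δ) := by have := Real.add_one_le_exp (Λ * δ); linarith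
  have he4 : 1 ≤ Real.exp (c * δ) := Real.one_le_exp (mul_nonneg h.c_nonneg hδ0.le)
  have he5 : 1 ≤ Real.exp (2 * ω * δ) := Real.one_le_exp (by positivity)
  have he6 : 1 ≤ Real.exp δ := Real.one_le_exp hδ0.le
  have h4 : formNorm (B t) v ≤ (1 + 2 * ω * δ) * formNorm (B t) (A t y) := by
    have h5 : formNorm (B t) v ≤ (1 + 2 * ω * δ) * ((1 - δ * ω) * formNorm (B t) v) := by
      have : 0 ≤ ω * δ * (1 - 2 * (δ * ω)) * formNorm (B t) v := by
        refine mul_nonneg (mul_nonneg (by positivity) (by linarith)) hv0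
      nlinarith
    exact h5.trans (mul_le_mul_of_nonneg_left h1 (by positivity))
  set Φ := stateSize B A s y with hΦ
  have hΦ1 : 1 ≤ Φ := one_le_stateSize B A s y
  have hΛ0 := h.lip_nonneg
  have hc0 := h.c_nonneg
  have h5 : formNorm (B t) v ≤ Real.exp (2 * ω * δ) *
      (Real.exp (c * δ) * formNorm (B s) (A s y) + Λ * δ * Φ) :=
    h4.trans (mul_le_mul he1 h2 (formNorm_nonneg _ _) (Real.exp_nonneg _))
  have hfy := formNorm_nonneg (B s) y
  have hfA := formNorm_nonneg (B s) (A s y)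
  have hK : 1 ≤ Real.exp δ * Real.exp (2 * ω * δ) := one_le_mul_of_one_le_of_one_le he6 he5
  calc stateSize B A t z
      ≤ Real.exp (c * δ) * (1 + formNorm (B s) y) + (1 + δ) * formNorm (B t) v := by
        unfold stateSize; linarith
    _ ≤ 1 * (Real.exp (c * δ) * (1 + formNorm (B s) y)) + Real.exp δ * (Real.exp (2 * ω * δ) *
        (Real.exp (c * δ) * formNorm (B s) (A s y) + Λ * δ * Φ)) := by
        rw [one_mul]
        exact add_le_add_right (mul_le_mul he2 h5 hv0 (Real.exp_nonneg _)) _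
    _ ≤ (Real.exp δ * Real.exp (2 * ω * δ)) * (Real.exp (c * δ) * (1 + formNorm (B s) y))
        + Real.exp δ * (Real.exp (2 * ω * δ) *
        (Real.exp (c * δ) * formNorm (B s) (A s y) + Λ * δ * Φ)) := by
        exact add_le_add_left (mul_le_mul_of_nonneg_right hK (by positivity)) _
    _ = (Real.exp δ * Real.exp (2 * ω * δ)) * (Real.exp (c * δ) + Λ * δ) * Φ := by
        rw [hΦ]; unfold stateSize; ring
    _ ≤ (Real.exp δ * Real.exp (2 * ω * δ)) * (Real.exp (c * δ) * Real.exp (Λ * δ)) * Φ := by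
        have : Real.exp (c * δ) + Λ * δ ≤ Real.exp (c * δ) * Real.exp (Λ * δ) := by
          have h6 : Λ * δ ≤ Real.exp (c * δ) * (Λ * δ) :=
            le_mul_of_one_le_left (by positivity) he4
          have h7 := mul_le_mul_of_nonneg_left he3 (Real.exp_nonneg (c * δ))
          linarith
        gcongr
    _ = Real.exp ((1 + 2 * ω + c + Λ) * δ) * Φ := by
        rw [← Real.exp_add, ← Real.exp_add, ← Real.exp_add]; congr 2; ring

/-! ### Passage to the limit with moving operators and norms. -/

section Limits

variable {ι : Type*} {l : Filter ι} {τ : ι → ℝ} {p : ι → X} {m : ι → ℝ} {t M : ℝ} {x : X}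

lemma tendsto_formNorm (h : IsEvolutionFamily T c ω κ Λ B D A) (ht : t ∈ Icc 0 T)
    (hτ : Tendsto τ l (𝓝 t)) (hτT : ∀ᶠ i in l, τ i ∈ Icc 0 T) (hp : Tendsto p l (𝓝 x)) :
    Tendsto (fun i => formNorm (B (τ i)) (p i)) l (𝓝 (formNorm (B t) x)) :=
  (tendsto_form_apply ((h.cont t ht).tendsto.comp (tendsto_nhdsWithin_iff.2 ⟨hτ, hτT⟩))
    hp hp).sqrt

/-- Freezes operator and norm at time `t`, with errors that vanish in the limit. The shift by `-(ω •
x)` gives the monotone operator the value `A t x` at `x`, so that the limiting bound is exactly the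
share of `A t x` in the state size. -/
lemma exists_bound (h : IsEvolutionFamily T c ω κ Λ B D A) (ht : t ∈ Icc 0 T)
    (hτ : Tendsto τ l (𝓝 t)) (hτT : ∀ᶠ i in l, τ i ∈ Icc 0 T) (hp : Tendsto p l (𝓝 x))
    (hD : ∀ᶠ i in l, p i ∈ D) (hm : ∀ᶠ i in l, stateSize B A (τ i) (p i) ≤ m i)
    (hM : Tendsto m l (𝓝 M)) :
    ∃ m' : ι → ℝ, (∀ᶠ i in l, formNorm (B t) (A t (p i) + ω • p i + -(ω • x)) ≤ m' i) ∧
      Tendsto m' l (𝓝 (M - 1 - formNorm (B t) x)) := by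
  have hB : Tendsto (fun i => √‖B t - B (τ i)‖) l (𝓝 0) := by
    have : Tendsto (fun i => B (τ i)) l (𝓝 (B t)) :=
      (h.cont t ht).tendsto.comp (tendsto_nhdsWithin_iff.2 ⟨hτ, hτT⟩)
    simp_rw [norm_sub_rev (B t)]
    simpa using (tendsto_iff_norm_sub_tendsto_zero.1 this).sqrt
  have hpx : Tendsto (fun i => ‖p i - x‖) l (𝓝 0) := by simpa using (hp.sub_const x).norm
  have hτt : Tendsto (fun i => |t - τ i|) l (𝓝 0) := by simpa using (hτ.const_sub t).abs
  refine ⟨fun i => m i - 1 - formNorm (B (τ i)) (p i) + √‖B t - B (τ i)‖ * (κ * m i)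
    + Λ * |t - τ i| * m i + ω * (κ * ‖p i - x‖), ?_, ?_⟩
  · filter_upwards [hτT, hD, hm] with i hi hpD hmi
    have hb := h.coercive t ht
    have hb' := h.coercive _ hi
    have hΛ := h.lip_nonneg
    set v := A (τ i) (p i) with hv
    rw [show A t (p i) + ω • p i + -(ω • x) = v + (A t (p i) - v) + ω • (p i - x) by
      rw [smul_sub]; abel]
    have h1 := hb.formNorm_add_le (v + (A t (p i) - v)) (ω • (p i - x))
    have h2 := hb.formNorm_add_le v (A t (p i) - v)
    rw [IsCoerciveForm.formNorm_smul _ h.omega_nonneg] at h1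
    have h3 := mul_le_mul_of_nonneg_left (hb.le_norm (p i - x)) h.omega_nonneg
    have h4 := (h.lip t ht _ hi t ht (p i) hpD).trans
      (mul_le_mul_of_nonneg_left hmi (by positivity))
    have h5 := formNorm_le_add hb hb' v
    have h6 : √‖B t - B (τ i)‖ * ‖v‖ ≤ √‖B t - B (τ i)‖ * (κ * m i) := by
      refine mul_le_mul_of_nonneg_left ((hb'.norm_le v).trans ?_) (Real.sqrt_nonneg _)
      exact mul_le_mul_of_nonneg_left ((formNorm_apply_le_stateSize B A _ _).trans hmi) hb.pos.le
    have h7 : formNorm (B (τ i)) v ≤ m i - 1 - formNorm (B (τ i)) (p i) := by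
      unfold stateSize at hmi; linarith
    linarith
  · have := ((((hM.sub_const 1).sub (h.tendsto_formNorm ht hτ hτT hp)).add
      (hB.mul (hM.const_mul κ))).add ((hτt.const_mul Λ).mul hM)).add
      ((hpx.const_mul κ).const_mul ω)
    simpa using this

/-- Lower semicontinuity of the state size, by demiclosedness of the frozen operator. -/
lemma mem_and_stateSize_le [l.NeBot] [CompleteSpace X] (h : IsEvolutionFamily T c ω κ Λ B D A)
    (ht : t ∈ Icc 0 T)
    (hτ : Tendsto τ l (𝓝 t)) (hτT : ∀ᶠ i in l, τ i ∈ Icc 0 T) (hp : Tendsto p l (𝓝 x))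
    (hD : ∀ᶠ i in l, p i ∈ D) (hm : ∀ᶠ i in l, stateSize B A (τ i) (p i) ≤ m i)
    (hM : Tendsto m l (𝓝 M)) : x ∈ D ∧ stateSize B A t x ≤ M := by
  obtain ⟨m', hm', hM'⟩ := h.exists_bound ht hτ hτT hp hD hm hM
  have hb := h.coercive t ht
  obtain ⟨hx, hle⟩ := ((h.maxMono t ht).add_const (-(ω • x))).mem_and_le_of_tendsto hb hp hD
    (m := fun i => m' i ^ 2) (hm'.mono fun i hi => by
      rw [← hb.sq_formNorm]; exact pow_le_pow_left₀ (formNorm_nonneg _ _) hi 2) (hM'.pow 2)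
  refine ⟨hx, ?_⟩
  rw [add_neg_cancel_right, ← hb.sq_formNorm] at hle
  have h0 : 0 ≤ M - 1 - formNorm (B t) x :=
    ge_of_tendsto hM' (hm'.mono fun i hi => (formNorm_nonneg _ _).trans hi)
  have := (abs_le_of_sq_le_sq' hle h0).2
  unfold stateSize
  linarith

/-- No loss of state size in the limit means no loss of norm in the frozen values, which upgrades
demiclosedness to strong convergence. -/
lemma tendsto_apply [l.NeBot] [CompleteSpace X] (h : IsEvolutionFamily T c ω κ Λ B D A)
    (ht : t ∈ Icc 0 T)
    (hτ : Tendsto τ l (𝓝 t)) (hτT : ∀ᶠ i in l, τ i ∈ Icc 0 T) (hp : Tendsto p l (𝓝 x))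
    (hD : ∀ᶠ i in l, p i ∈ D) (hm : ∀ᶠ i in l, stateSize B A (τ i) (p i) ≤ m i)
    (hM : Tendsto m l (𝓝 (stateSize B A t x))) :
    Tendsto (fun i => A (τ i) (p i)) l (𝓝 (A t x)) := by
  obtain ⟨m', hm', hM'⟩ := h.exists_bound ht hτ hτT hp hD hm hM
  have hb := h.coercive t ht
  have hM2 : Tendsto (fun i => m' i ^ 2) l
      (𝓝 (B t (A t x + ω • x + -(ω • x)) (A t x + ω • x + -(ω • x)))) := by
    rw [add_neg_cancel_right, ← hb.sq_formNorm]
    convert hM'.pow 2 using 3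
    unfold stateSize
    ring
  have h1 := ((h.maxMono t ht).add_const (-(ω • x))).tendsto_of_le hb hp hD
    (hm'.mono fun i hi => by
      rw [← hb.sq_formNorm]; exact pow_le_pow_left₀ (formNorm_nonneg _ _) hi 2) hM2
  have h2 : Tendsto (fun i => A (τ i) (p i) - A t (p i)) l (𝓝 0) := by
    have hτt : Tendsto (fun i => |t - τ i|) l (𝓝 0) := by simpa using (hτ.const_sub t).abs
    refine squeeze_zero_norm' (a := fun i => κ * (Λ * |t - τ i| * m i)) ?_ (by
      simpa using ((hτt.const_mul Λ).mul hM).const_mul κ)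
    filter_upwards [hτT, hD, hm] with i hi hpD hmi
    have hΛ := h.lip_nonneg
    rw [norm_sub_rev]
    refine (hb.norm_le _).trans (mul_le_mul_of_nonneg_left ?_ hb.pos.le)
    exact (h.lip t ht _ hi t ht (p i) hpD).trans (mul_le_mul_of_nonneg_left hmi (by positivity))
  have h3 := (h1.add h2).sub ((hp.sub_const x).const_smul ω)
  simp only [sub_self, smul_zero, sub_zero, add_zero, add_neg_cancel_right] at h3
  refine h3.congr fun i => ?_
  rw [smul_sub]
  abel

end Limits

end IsEvolutionFamily

/-! ### Approximate solutions by implicit Euler steps. -/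

/-- Approximate solutions on `[s, t]`: `w` has at `r` the right derivative `-A τ p` with `(τ, p)`
close to `(r, w r)`, and the state sizes are controlled by `M` with growth rate `C`. -/
structure IsApproxSolution (C : ℝ) (B : ℝ → X →L[ℝ] X →L[ℝ] ℝ) (D : Set X) (A : ℝ → X → X)
    (ε M s t : ℝ) (w : ℝ → X) : Prop where
  continuousOn : ContinuousOn w (Icc s t)
  exists_value : ∀ r ∈ Icc s t, ∃ τ ∈ Icc r t, τ ≤ r + ε ∧ ∃ p ∈ D, ‖w r - p‖ ≤ ε ∧
    stateSize B A τ p ≤ Real.exp (C * τ) * M ∧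
    (r < t → HasDerivWithinAt w (-(A τ p)) (Ici r) r)

namespace IsApproxSolution

variable {C : ℝ} {B : ℝ → X →L[ℝ] X →L[ℝ] ℝ} {D : Set X} {A : ℝ → X → X} {ε M s t : ℝ} {w : ℝ → X}

lemma restrict (h : IsApproxSolution C B D A ε M s t w) {s' : ℝ} (hs : s ≤ s') :
    IsApproxSolution C B D A ε M s' t w :=
  ⟨h.continuousOn.mono (Icc_subset_Icc_left hs),
    fun r hr => h.exists_value r ⟨hs.trans hr.1, hr.2⟩⟩

lemma mono_bound (h : IsApproxSolution C B D A ε M s t w) {M' : ℝ} (hM : M ≤ M') :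
    IsApproxSolution C B D A ε M' s t w := by
  refine ⟨h.continuousOn, fun r hr => ?_⟩
  obtain ⟨τ, hτ, hτε, p, hp, h1, h2, h3⟩ := h.exists_value r hr
  exact ⟨τ, hτ, hτε, p, hp, h1, h2.trans (by gcongr), h3⟩

lemma const {x : X} (hε : 0 ≤ ε) (hx : x ∈ D) (hM : stateSize B A s x ≤ Real.exp (C * s) * M) :
    IsApproxSolution C B D A ε M s s (fun _ => x) := by
  refine ⟨continuousOn_const, fun r hr => ?_⟩
  obtain rfl : r = s := le_antisymm hr.2 hr.1
  exact ⟨r, hr, by linarith, x, hx, by simpa using hε, hM, fun h => absurd h (lt_irrefl _)⟩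

/-- The joint belongs to the second piece, since right derivatives are prescribed. -/
lemma concat {t' : ℝ} {w' : ℝ → X} (hst : s ≤ t) (htt' : t ≤ t')
    (h : IsApproxSolution C B D A ε M s t w) (h' : IsApproxSolution C B D A ε M t t' w')
    (hw : w t = w' t) :
    IsApproxSolution C B D A ε M s t' (fun r => if r < t then w r else w' r) := by
  have hleft : EqOn (fun r => if r < t then w r else w' r) w (Icc s t) := fun r hr => by
    rcases hr.2.eq_or_lt with rfl | hlt
    · simp [hw]
    · simp [hlt]
  have hright : EqOn (fun r => if r < t then w r else w' r) w' (Ici t) := fun r hr => by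
    simp [not_lt.2 (show t ≤ r from hr)]
  refine ⟨?_, fun r hr => ?_⟩
  · rw [← Icc_union_Icc_eq_Icc hst htt']
    exact (h.continuousOn.congr hleft).union_of_isClosed
      (h'.continuousOn.congr (hright.mono Icc_subset_Ici_self)) isClosed_Icc isClosed_Icc
  · rcases lt_or_ge r t with hrt | hrt
    · obtain ⟨τ, hτ, hτε, p, hp, h1, h2, h3⟩ := h.exists_value r ⟨hr.1, hrt.le⟩
      refine ⟨τ, ⟨hτ.1, hτ.2.trans htt'⟩, hτε, p, hp, by simpa [hrt] using h1, h2, fun _ => ?_⟩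
      refine (h3 hrt).congr_of_eventuallyEq ?_ (by simp [hrt])
      filter_upwards [mem_nhdsWithin_of_mem_nhds (Iio_mem_nhds hrt)] with z hz
      simp [show z < t from hz]
    · obtain ⟨τ, hτ, hτε, p, hp, h1, h2, h3⟩ := h'.exists_value r ⟨hrt, hr.2⟩
      refine ⟨τ, hτ, hτε, p, hp, by simpa [not_lt.2 hrt] using h1, h2, fun hlt => ?_⟩
      exact (h3 hlt).congr (fun z hz => hright (mem_Ici.2 (hrt.trans hz))) (hright hrt)

end IsApproxSolution

namespace IsEvolutionFamily

variable {T c ω κ Λ : ℝ} {B : ℝ → X →L[ℝ] X →L[ℝ] ℝ} {D : Set X} {A : ℝ → X → X}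

/-- One implicit Euler step, interpolated linearly. -/
lemma exists_approxSolution_step [CompleteSpace X] (h : IsEvolutionFamily T c ω κ Λ B D A)
    {t t' ε M : ℝ} (ht : t ∈ Icc 0 T) (ht' : t' ∈ Icc 0 T) (htt' : t < t') {y : X} (hy : y ∈ D)
    (hM : stateSize B A t y ≤ Real.exp ((1 + 2 * ω + c + Λ) * t) * M) (hε : t' - t ≤ ε)
    (hω : (t' - t) * ω ≤ 1 / 2)
    (hε' : (t' - t) * (κ * (Real.exp ((1 + 2 * ω + c + Λ) * t') * M)) ≤ ε) :
    ∃ w, IsApproxSolution (1 + 2 * ω + c + Λ) B D A ε M t t' w ∧ w t = y ∧ w t' ∈ D ∧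
      stateSize B A t' (w t') ≤ Real.exp ((1 + 2 * ω + c + Λ) * t') * M := by
  obtain ⟨z, hz, hzy⟩ := h.exists_euler_step ⟨y, hy⟩ ht' (sub_pos.2 htt') hω y
  have hb := h.coercive t' ht'
  have hzM : stateSize B A t' z ≤ Real.exp ((1 + 2 * ω + c + Λ) * t') * M := by
    refine (h.stateSize_euler_step_le ht ht' htt' hω hy hz hzy).trans
      ((mul_le_mul_of_nonneg_left hM (Real.exp_nonneg _)).trans_eq ?_)
    rw [← mul_assoc, ← Real.exp_add]
    congr 2; ring
  have hv : ‖A t' z‖ ≤ κ * (Real.exp ((1 + 2 * ω + c + Λ) * t') * M) :=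
    (hb.norm_le _).trans (mul_le_mul_of_nonneg_left
      ((formNorm_apply_le_stateSize B A t' z).trans hzM) hb.pos.le)
  have hwt' : y - (t' - t) • A t' z = z := by rw [← hzy, add_sub_cancel_right]
  refine ⟨fun r => y - (r - t) • A t' z, ⟨by fun_prop, fun r hr => ?_⟩, by simp, ?_, ?_⟩
  -- The whole step uses its right endpoint: `τ = t'` and `p = z` for every `r`.
  · refine ⟨t', ⟨hr.2, le_rfl⟩, by linarith [hr.1], z, hz, ?_, hzM, fun _ => ?_⟩
    · have : y - (r - t) • A t' z - z = (t' - r) • A t' z := by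
        rw [← hzy]; module
      rw [this, norm_smul, Real.norm_of_nonneg (sub_nonneg.2 hr.2)]
      refine le_trans ?_ hε'
      exact mul_le_mul (by linarith [hr.1]) hv (norm_nonneg _) (by linarith)
    · have := (((hasDerivWithinAt_id r (Ici r)).sub_const t).smul_const (A t' z)).const_sub y
      simpa using this
  · simpa only [hwt'] using hz
  · simpa only [hwt'] using hzM

lemma exists_approxSolution [CompleteSpace X] (h : IsEvolutionFamily T c ω κ Λ B D A)
    {s ε M : ℝ} (hs : s ∈ Icc 0 T) (hε : 0 < ε) {x : X} (hx : x ∈ D)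
    (hM : stateSize B A s x ≤ Real.exp ((1 + 2 * ω + c + Λ) * s) * M) :
    ∃ w, IsApproxSolution (1 + 2 * ω + c + Λ) B D A ε M s T w ∧ w s = x := by
  rcases hs.2.eq_or_lt with rfl | hsT
  · exact ⟨_, .const hε.le hx hM, rfl⟩
  set C := 1 + 2 * ω + c + Λ with hC
  have hω0 := h.omega_nonneg
  have hc0 := h.c_nonneg
  have hΛ0 := h.lip_nonneg
  have hκ := (h.coercive s hs).pos
  have hC0 : 0 ≤ C := by positivity
  have hM0 : 0 < M := by
    have h1 := (one_le_stateSize B A s x).trans hM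
    exact pos_of_mul_pos_right (zero_lt_one.trans_le h1) (Real.exp_nonneg _)
  -- `δ * K ≤ 1` yields at once the three smallness conditions of a step: `δ ≤ ε`, `δ * ω ≤ 1 / 2`,
  -- and displacement at most `ε`.
  set K := 1 + 2 * ω + κ * (Real.exp (C * T) * M) / ε + 1 / ε with hK
  have hTs : 0 < T - s := sub_pos.2 hsT
  obtain ⟨n, hn⟩ := exists_nat_ge ((T - s) * K)
  have hK0 : 0 < K := by positivity
  have hn0 : (0 : ℝ) < n := (mul_pos hTs hK0).trans_le hn
  set δ := (T - s) / n with hδ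
  have hδ0 : 0 < δ := div_pos hTs hn0
  have hδK : δ * K ≤ 1 := by
    rw [hδ, div_mul_eq_mul_div, div_le_one hn0]; exact hn
  have hδ1 : δ ≤ ε := by
    have h1 : δ * (1 / ε) ≤ 1 := le_trans (mul_le_mul_of_nonneg_left
      (by rw [hK]; exact le_add_of_nonneg_left (by positivity)) hδ0.le) hδK
    rwa [mul_one_div, div_le_one hε] at h1
  have hδ2 : δ * ω ≤ 1 / 2 := by
    have h1 : δ * (2 * ω) ≤ 1 := le_trans (mul_le_mul_of_nonneg_left
      (by
        have : 0 ≤ κ * (Real.exp (C * T) * M) / ε + 1 / ε := by positivity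
        rw [hK]; linarith) hδ0.le) hδK
    linarith
  have hδ3 : δ * (κ * (Real.exp (C * T) * M)) ≤ ε := by
    have h1 : δ * (κ * (Real.exp (C * T) * M) / ε) ≤ 1 := le_trans (mul_le_mul_of_nonneg_left
      (by
        have : 0 < 1 / ε := by positivity
        rw [hK]; linarith) hδ0.le) hδK
    rwa [← mul_div_assoc, div_le_one hε] at h1
  have hnδ : s + n * δ = T := by
    rw [hδ, mul_div_cancel₀ _ hn0.ne']; ring
  have key : ∀ k : ℕ, k ≤ n → ∃ w, IsApproxSolution C B D A ε M s (s + k * δ) w ∧ w s = x ∧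
      w (s + k * δ) ∈ D ∧ stateSize B A (s + k * δ) (w (s + k * δ))
        ≤ Real.exp (C * (s + k * δ)) * M := by
    intro k
    induction k with
    | zero =>
      intro _
      simp only [Nat.cast_zero, zero_mul, add_zero]
      exact ⟨_, .const hε.le hx hM, rfl, hx, hM⟩
    | succ k ih =>
      intro hk
      obtain ⟨w, hw, hws, hwD, hwM⟩ := ih (by omega)
      have hstep : s + (k + 1 : ℕ) * δ = s + k * δ + δ := by push_cast; ring
      have hkT : s + (k + 1 : ℕ) * δ ≤ T := by
        rw [← hnδ]; gcongr
      have hk0 : 0 ≤ k * δ := by positivity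
      have ht : s + k * δ ∈ Icc 0 T := ⟨by linarith [hs.1], by linarith⟩
      have ht' : s + (k + 1 : ℕ) * δ ∈ Icc 0 T := ⟨by linarith [hs.1], hkT⟩
      have hdiff : s + (k + 1 : ℕ) * δ - (s + k * δ) = δ := by linarith
      obtain ⟨w', hw', hws', hwD', hwM'⟩ := h.exists_approxSolution_step (ε := ε) ht ht'
        (by linarith) hwD hwM (by rwa [hdiff]) (by rwa [hdiff]) (by
          rw [hdiff]
          refine le_trans ?_ hδ3
          gcongr)
      refine ⟨_, hw.concat (by linarith) (by linarith) hw' hws'.symm, ?_, ?_, ?_⟩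
      -- For `k = 0` the first piece is the single point `s`, so the value at `s` comes from the
      -- second piece.
      · rcases hk0.eq_or_lt with h0 | h0
        · rw [← h0, add_zero] at hws'
          simp [← h0, hws', hws]
        · simp [h0, hws]
      · have : ¬ (s + (k + 1 : ℕ) * δ < s + k * δ) := by linarith
        simpa only [this, if_false] using hwD'
      · have : ¬ (s + (k + 1 : ℕ) * δ < s + k * δ) := by linarith
        simpa only [this, if_false] using hwM'
  obtain ⟨w, hw, hws, -⟩ := key n le_rfl
  exact ⟨w, hnδ ▸ hw, hws⟩

/-! ### Comparison of approximate solutions. -/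

/-- A one-sided estimate for the growth of `B r (d r) (d r)`. -/
lemma eventually_sub_le (h : IsEvolutionFamily T c ω κ Λ B D A) {d : ℝ → X} {d' : X} {r E : ℝ}
    (hr : r ∈ Ico 0 T) (hd : HasDerivWithinAt d d' (Ici r) r) (hE : 0 ≤ E)
    (hle : B r (d r) d' ≤ ω * B r (d r) (d r) + E) {η : ℝ} (hη : 0 < η) :
    ∀ᶠ z in 𝓝[>] r, Real.exp (-2 * (c + ω) * z) * B z (d z) (d z)
      - Real.exp (-2 * (c + ω) * r) * B r (d r) (d r) ≤ (2 * E + η) * (z - r) := by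
  have hrT : r ∈ Icc 0 T := ⟨hr.1, hr.2.le⟩
  have hb := h.coercive r hrT
  have hBd : HasDerivWithinAt (fun z => B r (d z) (d z)) (2 * B r (d r) d') (Ioi r) r := by
    have hd1 := hd.mono Ioi_subset_Ici_self
    have := ((B r).hasFDerivAt.comp_hasDerivWithinAt r hd1).clm_apply hd1
    refine this.congr_deriv ?_
    rw [hb.symm d' (d r), Function.comp_apply]
    ring
  -- The form is frozen at `r`: the growth bound replaces `B z` by `exp (2 * c * (z - r))` times `B
  -- r`, giving a right-differentiable majorant that agrees at `z = r`.
  have hex : HasDerivWithinAt (fun z => Real.exp (-2 * ω * z - 2 * c * r))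
      (Real.exp (-2 * ω * r - 2 * c * r) * (-2 * ω)) (Ioi r) r := by
    have := (((hasDerivAt_id r).const_mul (-2 * ω)).sub_const (2 * c * r)).exp
    simpa using this.hasDerivWithinAt
  have hG := hex.mul hBd
  have hlt : Real.exp (-2 * ω * r - 2 * c * r) * (-2 * ω) * B r (d r) (d r) +
      Real.exp (-2 * ω * r - 2 * c * r) * (2 * B r (d r) d') < 2 * E + η := by
    have h1 : Real.exp (-2 * ω * r - 2 * c * r) ≤ 1 := by
      rw [Real.exp_le_one_iff]
      have := mul_nonneg h.omega_nonneg hr.1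
      have := mul_nonneg h.c_nonneg hr.1
      linarith
    have h2 := mul_le_mul_of_nonneg_left hle (Real.exp_nonneg (-2 * ω * r - 2 * c * r))
    have h3 := mul_le_mul_of_nonneg_right h1 hE
    linarith
  filter_upwards [hG.limsup_slope_le' (lt_irrefl r) hlt, Ioo_mem_nhdsGT hr.2] with z hz hzT
  have hzr : 0 < z - r := sub_pos.2 hzT.1
  rw [slope_def_field, div_lt_iff₀ hzr] at hz
  refine le_trans (sub_le_sub ?_ (le_of_eq ?_)) hz.le
  · have h1 := h.growth r hrT z ⟨hr.1.trans hzT.1.le, hzT.2.le⟩ hzT.1.le (d z)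
    have h2 := mul_le_mul_of_nonneg_left h1 (Real.exp_nonneg (-2 * (c + ω) * z))
    rw [← mul_assoc, ← Real.exp_add] at h2
    refine h2.trans_eq ?_
    simp only [Pi.mul_apply]
    congr 2; ring
  · simp only [Pi.mul_apply]
    congr 2; ring

/-- The basic dissipativity estimate for two approximate states. -/
lemma apply_sub_le (h : IsEvolutionFamily T c ω κ Λ B D A) {P r τ₁ τ₂ ε₁ ε₂ : ℝ}
    {p₁ p₂ w₁ w₂ : X} (hr : r ∈ Icc 0 T) (hτ₁ : τ₁ ∈ Icc r T) (hτ₂ : τ₂ ∈ Icc r T)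
    (hτε₁ : τ₁ ≤ r + ε₁) (hτε₂ : τ₂ ≤ r + ε₂) (hp₁ : p₁ ∈ D) (hp₂ : p₂ ∈ D)
    (hw₁ : ‖w₁ - p₁‖ ≤ ε₁) (hw₂ : ‖w₂ - p₂‖ ≤ ε₂)
    (hP₁ : stateSize B A τ₁ p₁ ≤ P) (hP₂ : stateSize B A τ₂ p₂ ≤ P) :
    B r (w₁ - w₂) (-(A τ₁ p₁) - -(A τ₂ p₂)) ≤ ω * B r (w₁ - w₂) (w₁ - w₂)
      + (4 * κ ^ 3 * P * ω + 2 * κ ^ 2 * P * Λ * P + 2 * κ ^ 3 * P) * (ε₁ + ε₂) := by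
  have hb := h.coercive r hr
  have hω0 := h.omega_nonneg
  have hΛ0 := h.lip_nonneg
  have hκ := hb.pos
  have hbound : ∀ τ ∈ Icc r T, ∀ v, formNorm (B τ) v ≤ P → formNorm (B r) v ≤ κ ^ 2 * P := by
    intro τ hτ v hv
    refine (hb.le_norm v).trans ?_
    have := ((h.coercive τ ⟨hr.1.trans hτ.1, hτ.2⟩).norm_le v).trans
      (mul_le_mul_of_nonneg_left hv hκ.le)
    rw [sq, mul_assoc]
    exact mul_le_mul_of_nonneg_left this hκ.le
  have hlip : ∀ τ ∈ Icc r T, ∀ ε, τ ≤ r + ε → ∀ p ∈ D, stateSize B A τ p ≤ P →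
      formNorm (B r) (A r p - A τ p) ≤ Λ * ε * P := by
    intro τ hτ ε hε p hp hP
    refine (h.lip r hr τ ⟨hr.1.trans hτ.1, hτ.2⟩ r hr p hp).trans ?_
    have h0 : |r - τ| ≤ ε := by
      rw [abs_sub_comm, abs_of_nonneg (sub_nonneg.2 hτ.1)]; linarith
    have h1 := zero_le_one.trans (one_le_stateSize B A τ p)
    have h2 : 0 ≤ ε := (abs_nonneg _).trans h0
    gcongr
  have hP0 : 0 ≤ P := (zero_le_one.trans (one_le_stateSize B A τ₁ p₁)).trans hP₁
  set q := p₁ - p₂ with hq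
  set Y' := A τ₁ p₁ - A τ₂ p₂ with hY'
  set Y := A r p₁ - A r p₂ with hY
  set e := (w₁ - p₁) - (w₂ - p₂) with he
  have hd : w₁ - w₂ = q + e := by rw [hq, he]; abel
  have hNq : formNorm (B r) q ≤ 2 * (κ ^ 2 * P) := by
    have h1 := hbound τ₁ hτ₁ p₁ ((formNorm_le_stateSize B A _ _).trans hP₁)
    have h2 := hbound τ₂ hτ₂ p₂ ((formNorm_le_stateSize B A _ _).trans hP₂)
    have := hb.formNorm_sub_le p₁ p₂
    linarith
  have hNY' : formNorm (B r) Y' ≤ 2 * (κ ^ 2 * P) := by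
    have h1 := hbound τ₁ hτ₁ _ ((formNorm_apply_le_stateSize B A _ _).trans hP₁)
    have h2 := hbound τ₂ hτ₂ _ ((formNorm_apply_le_stateSize B A _ _).trans hP₂)
    have := hb.formNorm_sub_le (A τ₁ p₁) (A τ₂ p₂)
    linarith
  have hNYY : formNorm (B r) (Y - Y') ≤ Λ * (ε₁ + ε₂) * P := by
    have h1 := hlip τ₁ hτ₁ ε₁ hτε₁ p₁ hp₁ hP₁
    have h2 := hlip τ₂ hτ₂ ε₂ hτε₂ p₂ hp₂ hP₂
    have h3 := hb.formNorm_sub_le (A r p₁ - A τ₁ p₁) (A r p₂ - A τ₂ p₂)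
    rw [hY, hY', sub_sub_sub_comm]
    linarith
  have hNe : formNorm (B r) e ≤ κ * (ε₁ + ε₂) :=
    (hb.le_norm e).trans (mul_le_mul_of_nonneg_left
      ((norm_sub_le _ _).trans (add_le_add hw₁ hw₂)) hκ.le)
  have hε0 : 0 ≤ ε₁ + ε₂ :=
    add_nonneg ((norm_nonneg _).trans hw₁) ((norm_nonneg _).trans hw₂)
  have h1 := h.quasi_monotone hr hp₁ hp₂
  rw [← hY, ← hq, hb.symm Y q] at h1
  have h2 : B r q (Y - Y') ≤ 2 * (κ ^ 2 * P) * (Λ * (ε₁ + ε₂) * P) :=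
    (hb.apply_le _ _).trans (mul_le_mul hNq hNYY (formNorm_nonneg _ _) (by positivity))
  have h3 : -(κ * (ε₁ + ε₂) * (2 * (κ ^ 2 * P))) ≤ B r e Y' :=
    (neg_le_neg (mul_le_mul hNe hNY' (formNorm_nonneg _ _) (by positivity))).trans
      (hb.neg_le_apply _ _)
  have h4 : -(2 * (κ ^ 2 * P) * (κ * (ε₁ + ε₂))) ≤ B r q e :=
    (neg_le_neg (mul_le_mul hNq hNe (formNorm_nonneg _ _) (by positivity))).trans
      (hb.neg_le_apply _ _)
  have h5 := hb.nonneg e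
  have h6 : B r q q ≤ B r (q + e) (q + e) + 2 * (2 * (κ ^ 2 * P) * (κ * (ε₁ + ε₂))) := by
    simp only [map_add, add_apply, hb.symm e q]
    linarith
  have h7 := mul_le_mul_of_nonneg_left h6 hω0
  rw [show -(A τ₁ p₁) - -(A τ₂ p₂) = -Y' by rw [hY']; abel, hd]
  -- `B r q Y` is controlled by quasi-monotonicity at the common time `r`; `Y - Y'` is the cost of
  -- moving `τ₁, τ₂` to `r`, and `e` that of replacing `w` by `p`, both of order `ε₁ + ε₂`.
  have h8 : B r (q + e) (-Y') = B r q (Y - Y') - B r q Y - B r e Y' := by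
    simp only [map_add, map_neg, map_sub, add_apply]
    ring
  rw [h8]
  linarith

/-- Comparison of two approximate solutions. -/
lemma exists_sq_dist_le (h : IsEvolutionFamily T c ω κ Λ B D A) (hT : 0 ≤ T) (M : ℝ) :
    ∃ E, 0 ≤ E ∧ ∀ ε₁ ε₂ s, 0 ≤ s → ∀ w₁ w₂,
      IsApproxSolution (1 + 2 * ω + c + Λ) B D A ε₁ M s T w₁ →
      IsApproxSolution (1 + 2 * ω + c + Λ) B D A ε₂ M s T w₂ →
      ∀ r ∈ Icc s T, ‖w₁ r - w₂ r‖ ^ 2 ≤ E * (‖w₁ s - w₂ s‖ ^ 2 + (ε₁ + ε₂)) := by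
  have hω0 := h.omega_nonneg
  have hΛ0 := h.lip_nonneg
  have hc0 := h.c_nonneg
  have hκ := (h.coercive 0 ⟨le_rfl, hT⟩).pos
  set C := 1 + 2 * ω + c + Λ with hC
  have hC0 : 0 ≤ C := by positivity
  -- The constant is fixed before any approximate solution is given, so nothing is known yet about
  -- the sign of `M`.
  set P := Real.exp (C * T) * |M| with hP
  set F := 4 * κ ^ 3 * P * ω + 2 * κ ^ 2 * P * Λ * P + 2 * κ ^ 3 * P with hF
  have hP0 : 0 ≤ P := by positivity
  have hF0 : 0 ≤ F := by positivity
  refine ⟨κ ^ 2 * (Real.exp (2 * (c + ω) * T) * (κ ^ 2 + 2 * F * T)), by positivity, ?_⟩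
  intro ε₁ ε₂ s hs w₁ w₂ h₁ h₂ r hr
  have hε0 : 0 ≤ ε₁ + ε₂ := by
    obtain ⟨_, _, _, _, _, h3, _⟩ := h₁.exists_value r hr
    obtain ⟨_, _, _, _, _, h4, _⟩ := h₂.exists_value r hr
    exact add_nonneg ((norm_nonneg _).trans h3) ((norm_nonneg _).trans h4)
  have hsub : Icc s r ⊆ Icc 0 T := Icc_subset_Icc hs hr.2
  have hcont : ContinuousOn (fun z => Real.exp (-2 * (c + ω) * z) *
      B z (w₁ z - w₂ z) (w₁ z - w₂ z)) (Icc s r) := by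
    refine ContinuousOn.mul (by fun_prop) fun z hz => ?_
    have hd : Tendsto (fun z => w₁ z - w₂ z) (𝓝[Icc s r] z) (𝓝 (w₁ z - w₂ z)) :=
      (h₁.continuousOn.mono (Icc_subset_Icc_right hr.2) z hz).tendsto.sub
        (h₂.continuousOn.mono (Icc_subset_Icc_right hr.2) z hz).tendsto
    exact tendsto_form_apply (h.cont.mono hsub z hz).tendsto hd hd
  have hmain := sub_le_of_eventually_slope_le (E := 2 * (F * (ε₁ + ε₂))) hr.1 hcont
    countable_empty fun z hz _ η hη => by
      have hzT : z < T := hz.2.trans_le hr.2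
      obtain ⟨τ₁, hτ₁, hτε₁, p₁, hp₁, hw₁, hs₁, hd₁⟩ := h₁.exists_value z ⟨hz.1, hzT.le⟩
      obtain ⟨τ₂, hτ₂, hτε₂, p₂, hp₂, hw₂, hs₂, hd₂⟩ := h₂.exists_value z ⟨hz.1, hzT.le⟩
      have hPτ : ∀ τ, τ ≤ T → Real.exp (C * τ) * M ≤ P := fun τ hτ =>
        (mul_le_mul_of_nonneg_left (le_abs_self M) (Real.exp_nonneg _)).trans
          (by rw [hP]; gcongr)
      have hz0 : 0 ≤ z := hs.trans hz.1
      refine h.eventually_sub_le ⟨hz0, hzT⟩ ((hd₁ hzT).sub (hd₂ hzT)) (by positivity) ?_ hη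
      exact h.apply_sub_le ⟨hz0, hzT.le⟩ hτ₁ hτ₂ hτε₁ hτε₂ hp₁ hp₂ hw₁ hw₂
        (hs₁.trans (hPτ _ hτ₁.2)) (hs₂.trans (hPτ _ hτ₂.2))
  have hb := h.coercive r (hsub ⟨hr.1, le_rfl⟩)
  have hbs := h.coercive s (hsub ⟨le_rfl, hr.1⟩)
  have h1 : Real.exp (-2 * (c + ω) * s) * B s (w₁ s - w₂ s) (w₁ s - w₂ s) ≤
      κ ^ 2 * ‖w₁ s - w₂ s‖ ^ 2 := by
    have h2 : B s (w₁ s - w₂ s) (w₁ s - w₂ s) ≤ κ ^ 2 * ‖w₁ s - w₂ s‖ ^ 2 := by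
      rw [← hbs.sq_formNorm, ← mul_pow]
      exact pow_le_pow_left₀ (formNorm_nonneg _ _) (hbs.le_norm _) 2
    refine (mul_le_of_le_one_left (hbs.nonneg _) ?_).trans h2
    rw [Real.exp_le_one_iff]
    have : 0 ≤ (c + ω) * s := by positivity
    linarith
  have h2 : 2 * (F * (ε₁ + ε₂)) * (r - s) ≤ 2 * F * T * (ε₁ + ε₂) := by
    have : 2 * (F * (ε₁ + ε₂)) * (r - s) ≤ 2 * (F * (ε₁ + ε₂)) * T := by
      gcongr; linarith [hr.2]
    linarith
  have hsq := sq_nonneg ‖w₁ s - w₂ s‖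
  have h3 : Real.exp (-2 * (c + ω) * r) * B r (w₁ r - w₂ r) (w₁ r - w₂ r) ≤
      (κ ^ 2 + 2 * F * T) * (‖w₁ s - w₂ s‖ ^ 2 + (ε₁ + ε₂)) := by
    have h4 : 0 ≤ κ ^ 2 * (ε₁ + ε₂) := by positivity
    have h5 : 0 ≤ 2 * F * T * ‖w₁ s - w₂ s‖ ^ 2 := by positivity
    linarith
  have h4 : B r (w₁ r - w₂ r) (w₁ r - w₂ r) ≤ Real.exp (2 * (c + ω) * T) *
      ((κ ^ 2 + 2 * F * T) * (‖w₁ s - w₂ s‖ ^ 2 + (ε₁ + ε₂))) := by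
    have h5 := mul_le_mul_of_nonneg_left h3 (Real.exp_nonneg (2 * (c + ω) * r))
    rw [← mul_assoc, ← Real.exp_add,
      show 2 * (c + ω) * r + -2 * (c + ω) * r = 0 by ring, Real.exp_zero, one_mul] at h5
    refine h5.trans (mul_le_mul_of_nonneg_right (Real.exp_le_exp.2 ?_) (by positivity))
    exact mul_le_mul_of_nonneg_left hr.2 (by positivity)
  refine (hb.sq_norm_le _).trans ((mul_le_mul_of_nonneg_left h4 (sq_nonneg κ)).trans_eq ?_)
  ring

end IsEvolutionFamily

/-! ### From right derivatives to derivatives, and the limit function. -/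

/-- A continuous function with a right derivative `g` everywhere is differentiable where `g` is
continuous. -/
lemma hasDerivWithinAt_of_right {u g : ℝ → X} {a b t : ℝ} (hu : ContinuousOn u (Icc a b))
    (hd : ∀ r ∈ Ico a b, HasDerivWithinAt u (g r) (Ici r) r) (ht : t ∈ Icc a b)
    (hg : ContinuousWithinAt g (Icc a b) t) : HasDerivWithinAt u (g t) (Icc a b) t := by
  rw [hasDerivWithinAt_iff_isLittleO, Asymptotics.isLittleO_iff]
  intro η hη
  obtain ⟨δ, hδ, hball⟩ := Metric.continuousWithinAt_iff.1 hg η hη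
  have key : ∀ x ∈ Icc a b, ∀ y ∈ Icc a b, |x - t| < δ → |y - t| < δ → x ≤ y →
      ‖u y - u x - (y - x) • g t‖ ≤ η * (y - x) := by
    intro x hx y hy hxδ hyδ hxy
    have h1 := norm_image_sub_le_of_norm_deriv_right_le_segment
      (f := fun z => u z - z • g t) (f' := fun z => g z - g t) (C := η) (a := x) (b := y)
      ((hu.mono (Icc_subset_Icc hx.1 hy.2)).sub (by fun_prop))
      (fun z hz => by
        have := (hd z ⟨hx.1.trans hz.1, hz.2.trans_le hy.2⟩).sub
          ((hasDerivWithinAt_id z (Ici z)).smul_const (g t))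
        exact this.congr_deriv (by rw [one_smul]))
      (fun z hz => by
        have hzt : dist z t < δ := by
          rw [abs_lt] at hxδ hyδ
          rw [Real.dist_eq, abs_lt]
          exact ⟨by linarith [hz.1, hxδ.1], by linarith [hz.2, hyδ.2]⟩
        rw [← dist_eq_norm]
        exact (hball ⟨hx.1.trans hz.1, hz.2.le.trans hy.2⟩ hzt).le) y ⟨hxy, le_rfl⟩
    refine le_of_eq_of_le (congrArg norm ?_) h1
    rw [sub_smul]; abel
  filter_upwards [mem_nhdsWithin_of_mem_nhds (Metric.ball_mem_nhds t hδ), self_mem_nhdsWithin]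
    with r hr hrI
  rw [Metric.mem_ball, Real.dist_eq] at hr
  rcases le_total t r with htr | htr
  · rw [Real.norm_of_nonneg (sub_nonneg.2 htr)]
    exact key t ht r hrI (by simpa using hδ) hr htr
  · rw [Real.norm_of_nonpos (sub_nonpos.2 htr), neg_sub, ← norm_neg]
    refine le_of_eq_of_le (congrArg norm ?_) (key r hrI t ht hr (by simpa using hδ) htr)
    rw [sub_smul, sub_smul]; abel

namespace IsEvolutionFamily

variable {T c ω κ Λ : ℝ} {B : ℝ → X →L[ℝ] X →L[ℝ] ℝ} {D : Set X} {A : ℝ → X → X}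

lemma rate_nonneg (h : IsEvolutionFamily T c ω κ Λ B D A) : 0 ≤ 1 + 2 * ω + c + Λ := by
  have := h.c_nonneg
  have := h.omega_nonneg
  have := h.lip_nonneg
  positivity

/-- The implicit Euler approximations converge. -/
lemma exists_limit [CompleteSpace X] (h : IsEvolutionFamily T c ω κ Λ B D A) (hT : 0 ≤ T) {a : X}
    (ha : a ∈ D) : ∃ u : ℝ → X, ∃ E, u 0 = a ∧ ∀ s ∈ Icc 0 T, ∀ ε w,
      IsApproxSolution (1 + 2 * ω + c + Λ) B D A ε (stateSize B A 0 a) s T w →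
      ∀ r ∈ Icc s T, ‖w r - u r‖ ^ 2 ≤ E * (‖w s - u s‖ ^ 2 + ε) := by
  have h0 : (0 : ℝ) ∈ Icc 0 T := ⟨le_rfl, hT⟩
  obtain ⟨E, hE0, hE⟩ := h.exists_sq_dist_le hT (stateSize B A 0 a)
  choose w hw hwa using fun n : ℕ => h.exists_approxSolution (M := stateSize B A 0 a) h0
    (Nat.one_div_pos_of_nat (α := ℝ) (n := n)) ha (by simp)
  have hlim : ∀ r ∈ Icc 0 T, ∃ y, Tendsto (fun n => w n r) atTop (𝓝 y) := fun r hr =>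
    cauchySeq_tendsto_of_complete (cauchySeq_of_sq_norm_le (C := E) fun n m => by
      simpa [hwa] using hE _ _ 0 le_rfl _ _ (hw n) (hw m) r hr)
  choose! u hu using hlim
  refine ⟨u, E, tendsto_nhds_unique (hu 0 h0) (by simp [hwa]), fun s hs ε v hv r hr => ?_⟩
  have h1 : Tendsto (fun n => ‖v r - w n r‖ ^ 2) atTop (𝓝 (‖v r - u r‖ ^ 2)) :=
    ((hu r ⟨hs.1.trans hr.1, hr.2⟩).const_sub (v r)).norm.pow 2
  have h2 : Tendsto (fun n : ℕ => E * (‖v s - w n s‖ ^ 2 + (ε + 1 / ((n : ℝ) + 1)))) atTop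
      (𝓝 (E * (‖v s - u s‖ ^ 2 + (ε + 0)))) :=
    ((((hu s hs).const_sub (v s)).norm.pow 2).add
      ((tendsto_one_div_add_atTop_nhds_zero_nat (𝕜 := ℝ)).const_add ε)).const_mul E
  rw [add_zero] at h2
  -- Restricting `w n` to `[s, T]` keeps it an approximate solution, so `v` may start at any time
  -- and any value.
  exact le_of_tendsto_of_tendsto' h1 h2 fun n =>
    hE _ _ s hs.1 _ _ hv ((hw n).restrict hs.1) r hr

/-- Approximate solutions are Lipschitz continuous. -/
lemma norm_approx_sub_le (h : IsEvolutionFamily T c ω κ Λ B D A) {ε M s : ℝ} {w : ℝ → X}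
    (hs : s ∈ Icc 0 T) (hM : 0 ≤ M) (hw : IsApproxSolution (1 + 2 * ω + c + Λ) B D A ε M s T w)
    {r : ℝ} (hr : r ∈ Icc s T) :
    ‖w r - w s‖ ≤ κ * (Real.exp ((1 + 2 * ω + c + Λ) * T) * M) * (r - s) := by
  have hC := h.rate_nonneg
  choose! τ hτ hτε p hp h1 h2 h3 using hw.exists_value
  refine norm_image_sub_le_of_norm_deriv_right_le_segment hw.continuousOn
    (fun z hz => h3 z ⟨hz.1, hz.2.le⟩ hz.2) (fun z hz => ?_) r hr
  have hz' : z ∈ Icc s T := ⟨hz.1, hz.2.le⟩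
  have hτT : τ z ∈ Icc 0 T := ⟨hs.1.trans (hz.1.trans (hτ z hz').1), (hτ z hz').2⟩
  have hb := h.coercive _ hτT
  rw [norm_neg]
  refine (hb.norm_le _).trans (mul_le_mul_of_nonneg_left ?_ hb.pos.le)
  refine (formNorm_apply_le_stateSize B A _ _).trans ((h2 z hz').trans ?_)
  have := hτT.2
  gcongr

section Restart

variable {u : ℝ → X} {E M : ℝ}

/-- The limit is also the limit of approximate solutions started at a later time. -/
lemma exists_approx_tendsto [CompleteSpace X] (h : IsEvolutionFamily T c ω κ Λ B D A)
    (hu : ∀ s ∈ Icc 0 T, ∀ ε w, IsApproxSolution (1 + 2 * ω + c + Λ) B D A ε M s T w →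
      ∀ r ∈ Icc s T, ‖w r - u r‖ ^ 2 ≤ E * (‖w s - u s‖ ^ 2 + ε))
    {s M' : ℝ} (hs : s ∈ Icc 0 T) (hsD : u s ∈ D) (hMM : M' ≤ M)
    (hM : stateSize B A s (u s) ≤ Real.exp ((1 + 2 * ω + c + Λ) * s) * M') :
    ∃ w : ℕ → ℝ → X,
      (∀ n : ℕ, IsApproxSolution (1 + 2 * ω + c + Λ) B D A (1 / ((n : ℝ) + 1)) M' s T (w n)) ∧
      (∀ n, w n s = u s) ∧ ∀ r ∈ Icc s T, Tendsto (fun n => w n r) atTop (𝓝 (u r)) := by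
  choose w hw hws using fun n : ℕ => h.exists_approxSolution hs
    (Nat.one_div_pos_of_nat (α := ℝ) (n := n)) hsD hM
  refine ⟨w, hw, hws, fun r hr => ?_⟩
  rw [tendsto_iff_norm_sub_tendsto_zero]
  have h1 : Tendsto (fun n => ‖w n r - u r‖ ^ 2) atTop (𝓝 0) := by
    have h2 : Tendsto (fun n : ℕ => E * (1 / ((n : ℝ) + 1))) atTop (𝓝 0) := by
      simpa using (tendsto_one_div_add_atTop_nhds_zero_nat (𝕜 := ℝ)).const_mul E
    refine squeeze_zero (fun n => sq_nonneg _) (fun n => ?_) h2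
    simpa [hws] using hu s hs _ _ ((hw n).mono_bound hMM) r hr
  simpa [Real.sqrt_sq] using h1.sqrt

/-- The limit stays in the domain and its state size grows at most exponentially. -/
lemma limit_mem_and_le [CompleteSpace X] (h : IsEvolutionFamily T c ω κ Λ B D A)
    (hu : ∀ s ∈ Icc 0 T, ∀ ε w, IsApproxSolution (1 + 2 * ω + c + Λ) B D A ε M s T w →
      ∀ r ∈ Icc s T, ‖w r - u r‖ ^ 2 ≤ E * (‖w s - u s‖ ^ 2 + ε))
    {s M' : ℝ} (hs : s ∈ Icc 0 T) (hsD : u s ∈ D) (hMM : M' ≤ M)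
    (hM : stateSize B A s (u s) ≤ Real.exp ((1 + 2 * ω + c + Λ) * s) * M') {r : ℝ}
    (hr : r ∈ Icc s T) :
    (u r ∈ D ∧ stateSize B A r (u r) ≤ Real.exp ((1 + 2 * ω + c + Λ) * r) * M') ∧
      ‖u r - u s‖ ≤ κ * (Real.exp ((1 + 2 * ω + c + Λ) * T) * M') * (r - s) := by
  obtain ⟨w, hw, hws, hlim⟩ := h.exists_approx_tendsto hu hs hsD hMM hM
  have hM0 : 0 ≤ M' := by
    have h1 := (one_le_stateSize B A s (u s)).trans hM
    exact (pos_of_mul_pos_right (zero_lt_one.trans_le h1) (Real.exp_nonneg _)).le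
  have hone := tendsto_one_div_add_atTop_nhds_zero_nat (𝕜 := ℝ)
  choose τ hτ hτε p hp h1 h2 _ using fun n => (hw n).exists_value r hr
  have hτr : Tendsto τ atTop (𝓝 r) :=
    tendsto_of_tendsto_of_tendsto_of_le_of_le tendsto_const_nhds
      (by simpa using hone.const_add r) (fun n => (hτ n).1) hτε
  have hpu : Tendsto p atTop (𝓝 (u r)) := by
    have h3 : Tendsto (fun n => w n r - p n) atTop (𝓝 0) := squeeze_zero_norm h1 hone
    simpa using (hlim r hr).sub h3
  refine ⟨h.mem_and_stateSize_le ⟨hs.1.trans hr.1, hr.2⟩ hτr (Eventually.of_forall fun n =>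
    ⟨hs.1.trans (hr.1.trans (hτ n).1), (hτ n).2⟩) hpu (Eventually.of_forall hp)
    (Eventually.of_forall h2) ?_, ?_⟩
  · exact ((Real.continuous_exp.tendsto _).comp (hτr.const_mul _)).mul_const M'
  · refine le_of_tendsto' ((hlim r hr).sub_const (u s)).norm fun n => ?_
    rw [← hws n]
    exact h.norm_approx_sub_le hs hM0 (hw n) hr

/-- Values of the operators near a state whose size is almost maximal. -/
lemma exists_norm_apply_sub_le [CompleteSpace X] (h : IsEvolutionFamily T c ω κ Λ B D A)
    {s : ℝ} (hs : s ∈ Icc 0 T) (x : X) (C : ℝ) {η : ℝ} (hη : 0 < η) :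
    ∃ δ > 0, ∀ τ ∈ Icc 0 T, |τ - s| ≤ δ → ∀ p ∈ D, ‖p - x‖ ≤ δ →
      stateSize B A τ p ≤ Real.exp (C * (τ - s)) * stateSize B A s x →
      ‖A τ p - A s x‖ ≤ η := by
  by_contra! hcon
  choose τ hτ hτs p hp hpx hle hlt using fun n : ℕ =>
    hcon (1 / ((n : ℝ) + 1)) Nat.one_div_pos_of_nat
  have hone := tendsto_one_div_add_atTop_nhds_zero_nat (𝕜 := ℝ)
  have hτ0 : Tendsto (fun n => τ n - s) atTop (𝓝 0) := squeeze_zero_norm hτs hone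
  have hp0 : Tendsto (fun n => p n - x) atTop (𝓝 0) := squeeze_zero_norm hpx hone
  have h1 : Tendsto τ atTop (𝓝 s) := by simpa using hτ0.add_const s
  have h2 : Tendsto p atTop (𝓝 x) := by simpa using hp0.add_const x
  have h3 : Tendsto (fun n => Real.exp (C * (τ n - s)) * stateSize B A s x) atTop
      (𝓝 (stateSize B A s x)) := by
    simpa using ((Real.continuous_exp.tendsto _).comp (hτ0.const_mul C)).mul_const
      (stateSize B A s x)
  have h4 := h.tendsto_apply hs h1 (Eventually.of_forall hτ) h2 (Eventually.of_forall hp)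
    (Eventually.of_forall hle) h3
  have h5 := (h4.sub_const (A s x)).norm
  rw [sub_self, norm_zero] at h5
  obtain ⟨n, hn⟩ := (h5.eventually_lt_const hη).exists
  exact lt_irrefl _ ((hlt n).trans hn)

/-- The limit solves the equation with the right derivative. -/
lemma limit_hasDerivWithinAt_Ici [CompleteSpace X] (h : IsEvolutionFamily T c ω κ Λ B D A)
    (hu : ∀ s ∈ Icc 0 T, ∀ ε w, IsApproxSolution (1 + 2 * ω + c + Λ) B D A ε M s T w →
      ∀ r ∈ Icc s T, ‖w r - u r‖ ^ 2 ≤ E * (‖w s - u s‖ ^ 2 + ε))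
    {s : ℝ} (hs : s ∈ Ico 0 T) (hsD : u s ∈ D)
    (hM : stateSize B A s (u s) ≤ Real.exp ((1 + 2 * ω + c + Λ) * s) * M) :
    HasDerivWithinAt u (-(A s (u s))) (Ici s) s := by
  have hsT : s ∈ Icc 0 T := ⟨hs.1, hs.2.le⟩
  set C := 1 + 2 * ω + c + Λ with hC
  set y := A s (u s) with hy
  set M' := Real.exp (-(C * s)) * stateSize B A s (u s) with hM'
  have hee : Real.exp (C * s) * Real.exp (-(C * s)) = 1 := by
    rw [← Real.exp_add, add_neg_cancel, Real.exp_zero]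
  have hMs : Real.exp (C * s) * M' = stateSize B A s (u s) := by
    rw [hM', ← mul_assoc, hee, one_mul]
  have hMM : M' ≤ M := le_of_mul_le_mul_left (hMs.trans_le hM) (Real.exp_pos (C * s))
  have hM0 : 0 ≤ M' :=
    mul_nonneg (Real.exp_nonneg _) (zero_le_one.trans (one_le_stateSize B A s (u s)))
  obtain ⟨w, hw, hws, hlim⟩ := h.exists_approx_tendsto hu hsT hsD hMM hMs.ge
  set K := κ * (Real.exp (C * T) * M') with hK
  have hK0 : 0 ≤ K := mul_nonneg (h.coercive s hsT).pos.le (by positivity)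
  rw [hasDerivWithinAt_iff_isLittleO, Asymptotics.isLittleO_iff]
  intro η hη
  obtain ⟨δ, hδ, hball⟩ := h.exists_norm_apply_sub_le hsT (u s) C hη
  -- Half of `δ` covers the motion up to time `s + ρ`, the other half the discretisation error `1 /
  -- (n + 1)`.
  set ρ := δ / 2 / (1 + K) with hρ
  have hρ0 : 0 < ρ := by positivity
  have hρ1 : ρ * (1 + K) = δ / 2 := div_mul_cancel₀ _ (by positivity)
  have hρK : 0 ≤ ρ * K := by positivity
  have hmem : Ico s (min T (s + ρ)) ∈ 𝓝[≥] s :=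
    Ico_mem_nhdsGE (lt_min hs.2 (lt_add_of_pos_right s hρ0))
  filter_upwards [hmem] with r hr
  have hrT : r ≤ T := hr.2.le.trans (min_le_left _ _)
  have hrρ : r ≤ s + ρ := hr.2.le.trans (min_le_right _ _)
  rw [Real.norm_of_nonneg (sub_nonneg.2 hr.1)]
  have hlim' : Tendsto (fun n => ‖w n r - u s - (r - s) • -y‖) atTop
      (𝓝 ‖u r - u s - (r - s) • -y‖) :=
    (((hlim r ⟨hr.1, hrT⟩).sub_const (u s)).sub_const _).norm
  have hone := tendsto_one_div_add_atTop_nhds_zero_nat (𝕜 := ℝ)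
  refine le_of_tendsto hlim' ?_
  filter_upwards [hone.eventually_lt_const (half_pos hδ)] with n hn
  choose! τ hτ hτε p hp h1 h2 h3 using (hw n).exists_value
  have h4 := norm_image_sub_le_of_norm_deriv_right_le_segment
    (f := fun z => w n z + z • y) (f' := fun z => -(A (τ z) (p z)) + y) (C := η) (a := s) (b := r)
    (((hw n).continuousOn.mono (Icc_subset_Icc_right hrT)).add (by fun_prop))
    (fun z hz => by
      have := (h3 z ⟨hz.1, hz.2.le.trans hrT⟩ (hz.2.trans_le hrT)).add
        ((hasDerivWithinAt_id z (Ici z)).smul_const y)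
      exact this.congr_deriv (by rw [one_smul]))
    (fun z hz => by
      have hz' : z ∈ Icc s T := ⟨hz.1, hz.2.le.trans hrT⟩
      have hτz := hτ z hz'
      have hzρ : z - s ≤ ρ := by linarith [hz.2]
      rw [neg_add_eq_sub, norm_sub_rev]
      refine hball (τ z) ⟨hs.1.trans (hz.1.trans hτz.1), hτz.2⟩ ?_ (p z) (hp z hz') ?_ ?_
      · rw [abs_of_nonneg (by linarith [hτz.1, hz.1])]
        linarith [hτε z hz']
      · have h5 := h.norm_approx_sub_le hsT hM0 (hw n) hz'
        rw [hws n] at h5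
        have h6 : K * (z - s) ≤ K * ρ := mul_le_mul_of_nonneg_left hzρ hK0
        calc ‖p z - u s‖ = ‖(w n z - u s) - (w n z - p z)‖ := by congr 1; abel
          _ ≤ ‖w n z - u s‖ + ‖w n z - p z‖ := norm_sub_le _ _
          _ ≤ K * (z - s) + 1 / ((n : ℝ) + 1) := add_le_add h5 (h1 z hz')
          _ ≤ δ := by linarith
      · refine (h2 z hz').trans_eq ?_
        rw [hM', ← mul_assoc, ← Real.exp_add]
        congr 2; ring) r ⟨hr.1, le_rfl⟩
  refine le_of_eq_of_le (congrArg norm ?_) h4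
  simp only [hws n, sub_smul, smul_neg]
  abel

end Restart

/-! ### Existence and uniqueness for an evolution family. -/

/-- Existence of a Lipschitz continuous solution. -/
theorem exists_solution [CompleteSpace X] (h : IsEvolutionFamily T c ω κ Λ B D A) (hT : 0 ≤ T)
    {a : X} (ha : a ∈ D) : ∃ u : ℝ → X, u 0 = a ∧ (∀ t ∈ Icc 0 T, u t ∈ D) ∧
      (∃ K, LipschitzOnWith K u (Icc 0 T)) ∧
      ∃ N : Set ℝ, N.Countable ∧ ∀ t ∈ Icc 0 T \ N,
        HasDerivWithinAt u (-(A t (u t))) (Icc 0 T) t ∧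
          ContinuousWithinAt (fun s => -(A s (u s))) (Icc 0 T) t := by
  obtain ⟨u, E, hu0, hu⟩ := h.exists_limit hT ha
  have h0 : (0 : ℝ) ∈ Icc 0 T := ⟨le_rfl, hT⟩
  set C := 1 + 2 * ω + c + Λ with hC
  set M := stateSize B A 0 a with hM
  have hall : ∀ r ∈ Icc 0 T, u r ∈ D ∧ stateSize B A r (u r) ≤ Real.exp (C * r) * M := fun r hr =>
    (h.limit_mem_and_le hu h0 (hu0 ▸ ha) le_rfl (by simp [hu0, hM]) hr).1
  have hM0 : 0 ≤ M := zero_le_one.trans (one_le_stateSize B A 0 a)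
  have hκ := (h.coercive 0 h0).pos
  have hlip : ∃ K, LipschitzOnWith K u (Icc 0 T) := by
    refine ⟨⟨κ * (Real.exp (C * T) * M), by positivity⟩, LipschitzOnWith.of_dist_le_mul ?_⟩
    have key : ∀ s ∈ Icc 0 T, ∀ r ∈ Icc 0 T, s ≤ r →
        dist (u r) (u s) ≤ κ * (Real.exp (C * T) * M) * dist r s := fun s hs r hr hsr => by
      rw [dist_eq_norm, Real.dist_eq, abs_of_nonneg (sub_nonneg.2 hsr)]
      exact (h.limit_mem_and_le hu hs (hall s hs).1 le_rfl (hall s hs).2 ⟨hsr, hr.2⟩).2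
    intro r hr s hs
    rcases le_total s r with hsr | hsr
    · exact key s hs r hr hsr
    · rw [dist_comm (u r), dist_comm r]
      exact key r hr s hs hsr
  -- Restart at `s` with the least admissible constant; the exceptional set is the set of
  -- discontinuities of this function.
  have hanti : AntitoneOn (fun t => Real.exp (-(C * t)) * stateSize B A t (u t)) (Icc 0 T) := by
    intro s hs r hr hsr
    have hee : ∀ t, Real.exp (C * t) * Real.exp (-(C * t)) = 1 := fun t => by
      rw [← Real.exp_add, add_neg_cancel, Real.exp_zero]
    have h1 := (h.limit_mem_and_le hu hs (hall s hs).1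
      (M' := Real.exp (-(C * s)) * stateSize B A s (u s)) ?_ ?_ ⟨hsr, hr.2⟩).1.2
    · refine le_of_mul_le_mul_left ?_ (Real.exp_pos (C * r))
      rwa [← mul_assoc, hee, one_mul]
    · refine le_of_mul_le_mul_left ?_ (Real.exp_pos (C * s))
      rw [← mul_assoc, hee, one_mul]
      exact (hall s hs).2
    · rw [← mul_assoc, hee, one_mul]
  refine ⟨u, hu0, fun t ht => (hall t ht).1, hlip, _, hanti.countable_not_continuousWithinAt, ?_⟩
  rintro t ⟨ht, htN⟩
  have hcont : ContinuousWithinAt (fun t => Real.exp (-(C * t)) * stateSize B A t (u t))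
      (Icc 0 T) t := by
    by_contra hcon
    exact htN ⟨ht, hcon⟩
  have huc : ContinuousOn u (Icc 0 T) := hlip.elim fun K hK => hK.continuousOn
  have hAc : ContinuousWithinAt (fun s => -(A s (u s))) (Icc 0 T) t := by
    have : (𝓝[Icc 0 T] t).NeBot := mem_closure_iff_nhdsWithin_neBot.1 (subset_closure ht)
    have hid : Tendsto (fun s : ℝ => s) (𝓝[Icc 0 T] t) (𝓝 t) :=
      tendsto_nhdsWithin_of_tendsto_nhds tendsto_id
    have hsize : Tendsto (fun s => stateSize B A s (u s)) (𝓝[Icc 0 T] t)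
        (𝓝 (stateSize B A t (u t))) := by
      have h1 : ∀ s, Real.exp (C * s) * (Real.exp (-(C * s)) * stateSize B A s (u s))
          = stateSize B A s (u s) := fun s => by
        rw [← mul_assoc, ← Real.exp_add, add_neg_cancel, Real.exp_zero, one_mul]
      have h2 := ((Real.continuous_exp.tendsto _).comp (hid.const_mul C)).mul hcont.tendsto
      simpa only [Function.comp_apply, h1] using h2
    exact (h.tendsto_apply ht hid self_mem_nhdsWithin (huc t ht).tendsto
      (eventually_mem_nhdsWithin.mono fun s hs => (hall s hs).1)
      (Eventually.of_forall fun s => le_rfl) hsize).neg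
  refine ⟨hasDerivWithinAt_of_right (g := fun s => -(A s (u s))) huc (fun r hr => ?_) ht hAc, hAc⟩
  have hr' : r ∈ Icc 0 T := ⟨hr.1, hr.2.le⟩
  exact h.limit_hasDerivWithinAt_Ici hu hr (hall r hr').1 (hall r hr').2

/-- Uniqueness of solutions. -/
theorem solution_unique (h : IsEvolutionFamily T c ω κ Λ B D A) {a : X} {u v : ℝ → X}
    (hu : IsCauchySolution T D A a u) (hv : IsCauchySolution T D A a v) :
    EqOn v u (Icc 0 T) := by
  intro r hr
  obtain ⟨N, hN, hNu⟩ := hu.equation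
  obtain ⟨N', hN', hNv⟩ := hv.equation
  have hsub : Icc 0 r ⊆ Icc 0 T := Icc_subset_Icc_right hr.2
  have hcont : ContinuousOn (fun z => Real.exp (-2 * (c + ω) * z) *
      B z (v z - u z) (v z - u z)) (Icc 0 r) := by
    refine ContinuousOn.mul (by fun_prop) fun z hz => ?_
    have hd : Tendsto (fun z => v z - u z) (𝓝[Icc 0 r] z) (𝓝 (v z - u z)) :=
      (hv.continuousOn.mono hsub z hz).tendsto.sub (hu.continuousOn.mono hsub z hz).tendsto
    exact tendsto_form_apply (h.cont.mono hsub z hz).tendsto hd hd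
  -- Both solutions satisfy the equation exactly off `N ∪ N'`, so no error term appears.
  have hmain := sub_le_of_eventually_slope_le (E := 2 * 0) hr.1 hcont (hN.union hN')
    fun z hz hzN η hη => by
      rw [mem_union, not_or] at hzN
      have hzT : z ∈ Ico 0 T := ⟨hz.1, hz.2.trans_le hr.2⟩
      have hz' : z ∈ Icc 0 T := ⟨hz.1, hzT.2.le⟩
      have hmem : Icc 0 T ∈ 𝓝[≥] z :=
        mem_of_superset (Icc_mem_nhdsGE hzT.2) (Icc_subset_Icc_left hz.1)
      refine h.eventually_sub_le hzT (((hNv z ⟨hz', hzN.2⟩).mono_of_mem_nhdsWithin hmem).sub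
        ((hNu z ⟨hz', hzN.1⟩).mono_of_mem_nhdsWithin hmem)) le_rfl ?_ hη
      have h1 := h.quasi_monotone hz' (hv.mem_domain z hz') (hu.mem_domain z hz')
      rw [(h.coercive z hz').symm (A z (v z) - A z (u z))] at h1
      change B z (v z - u z) (-(A z (v z)) - -(A z (u z))) ≤
        ω * B z (v z - u z) (v z - u z) + 0
      rw [← neg_sub', map_neg]
      linarith
  have hb := h.coercive r hr
  simp only [hu.initial, hv.initial, sub_self, map_zero, mul_zero, zero_mul, add_zero] at hmain
  have h1 : B r (v r - u r) (v r - u r) ≤ 0 := nonpos_of_mul_nonpos_right hmain (Real.exp_pos _)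
  have h2 := (hb.sq_norm_le (v r - u r)).trans
    (mul_nonpos_of_nonneg_of_nonpos (sq_nonneg κ) h1)
  exact sub_eq_zero.1 (norm_eq_zero.1
    (pow_eq_zero_iff two_ne_zero |>.1 (le_antisymm h2 (sq_nonneg _))))

end IsEvolutionFamily

end Forms

/-! ### From inner products over `𝕜` to real forms. -/

section InnerProducts

variable {𝕜 X : Type*} [RCLike 𝕜] [NormedAddCommGroup X] [InnerProductSpace 𝕜 X]
  [NormedSpace ℝ X] [IsScalarTower ℝ 𝕜 X]

/-- The real part of an inner product with equivalent norm, as a continuous bilinear form. -/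
lemma exists_form {I : InnerProductSpace.Core 𝕜 X} (hI : IsEquivalentIP I) :
    ∃ b : X →L[ℝ] X →L[ℝ] ℝ, ∀ u v, b u v = RCLike.re (I.inner u v) := by
  obtain ⟨m, M, hm, hM⟩ := hI
  have hcomm : ∀ u v, RCLike.re (I.inner u v) = RCLike.re (I.inner v u) := fun u v => by
    rw [← I.conj_inner_symm, RCLike.conj_re]
  have hadd : ∀ u v w, RCLike.re (I.inner (u + v) w) =
      RCLike.re (I.inner u w) + RCLike.re (I.inner v w) := fun u v w => by
    rw [I.add_left, map_add]
  have hsmul : ∀ (r : ℝ) (u v : X), RCLike.re (I.inner (r • u) v) =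
      r * RCLike.re (I.inner u v) := fun r u v => by
    rw [RCLike.real_smul_eq_coe_smul (K := 𝕜), I.smul_left, RCLike.conj_ofReal, RCLike.re_ofReal_mul]
  refine ⟨LinearMap.mkContinuous₂ (LinearMap.mk₂ ℝ (fun u v => RCLike.re (I.inner u v)) hadd
    hsmul (fun u v w => by rw [hcomm, hadd, hcomm v, hcomm w])
    (fun r u v => by rw [hcomm, hsmul, hcomm v, smul_eq_mul])) (M ^ 2) fun u v => ?_, fun u v => rfl⟩
  have h1 : ‖I.inner u v‖ ≤ ipNorm I u * ipNorm I v :=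
    @InnerProductSpace.Core.norm_inner_le_norm 𝕜 X _ _ _ I.toCore u v
  have h2 : ipNorm I u * ipNorm I v ≤ (M * ‖u‖) * (M * ‖v‖) :=
    mul_le_mul (hM u).2 (hM v).2 (Real.sqrt_nonneg _) ((Real.sqrt_nonneg _).trans (hM u).2)
  calc ‖RCLike.re (I.inner u v)‖ ≤ ‖I.inner u v‖ := RCLike.norm_re_le_norm _
    _ ≤ M ^ 2 * ‖u‖ * ‖v‖ := (h1.trans h2).trans_eq (by ring)

/-- A pair monotonically related to the graph can be inserted without losing monotonicity, so
maximality puts it in the graph. -/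
lemma isMaxMonotone_of_isMaximalQuasiMonotone {I : InnerProductSpace.Core 𝕜 X}
    {b : X →L[ℝ] X →L[ℝ] ℝ} (hb : ∀ u v, b u v = RCLike.re (I.inner u v)) {ω : ℝ} {D : Set X}
    {A : X → X} (h : IsMaximalQuasiMonotone I ω D A) :
    IsMaxMonotone b D (fun x => A x + ω • x) := by
  have hE : ∀ x, A x + (ω : 𝕜) • x = A x + ω • x := fun x => by
    rw [RCLike.real_smul_eq_coe_smul (K := 𝕜)]
  rw [IsMaximalQuasiMonotone] at h
  simp only [hE] at h
  refine ⟨fun x hx y hy => ?_, fun x y hxy => ?_⟩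
  · rw [hb]
    exact h.prop (x, A x + ω • x) ⟨x, hx, rfl⟩ (y, A y + ω • y) ⟨y, hy, rfl⟩
  · have hmono : IsMonotoneOperator I
        (insert (x, y) (graphOn (fun u => A u + ω • u) D)) := by
      rintro p (rfl | hp) q (rfl | hq)
      · rw [← hb]; simp
      · obtain ⟨z, hz, rfl⟩ := hq
        rw [← hb]
        exact hxy z hz
      · obtain ⟨z, hz, rfl⟩ := hp
        rw [← hb, ← neg_sub y, ← neg_sub x, map_neg, map_neg, neg_apply, neg_neg]
        exact hxy z hz
      · exact h.prop p hp q hq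
    obtain ⟨z, hz, hzxy⟩ := h.le_of_ge hmono (subset_insert _ _) (mem_insert (x, y) _)
    obtain ⟨rfl, rfl⟩ := Prod.mk.inj hzxy
    exact ⟨hz, rfl⟩

end InnerProducts

/-! ### Regularity of the forms in time. -/

section Regularity

variable {X : Type*} [NormedAddCommGroup X] [NormedSpace ℝ X]

/-- A family of symmetric bilinear forms with differentiable quadratic forms is continuous in
operator norm. -/
lemma continuousOn_form_of_hasDerivWithinAt [CompleteSpace X] {B : ℝ → X →L[ℝ] X →L[ℝ] ℝ}
    {S : Set ℝ} (hsymm : ∀ t ∈ S, ∀ u v, B t u v = B t v u)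
    (hd : ∀ u, ∀ t ∈ S, ∃ d, HasDerivWithinAt (fun s => B s u u) d S t) : ContinuousOn B S := by
  intro t ht
  refine tendsto_of_seq_tendsto fun x hx => ?_
  rw [tendsto_nhdsWithin_iff] at hx
  obtain ⟨n₀, hn₀⟩ := eventually_atTop.1 hx.2
  rw [← tendsto_add_atTop_iff_nat n₀]
  set y : ℕ → ℝ := fun n => x (n + n₀) with hy
  have hyS : ∀ n, y n ∈ S := fun n => hn₀ _ (Nat.le_add_left _ _)
  have hyt : Tendsto y atTop (𝓝 t) := (tendsto_add_atTop_iff_nat n₀).2 hx.1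
  -- Difference quotients, bounded on each `u` by differentiability and on each pair by
  -- polarisation. Uniform boundedness in each variable then gives `‖B (y n) - B t‖ ≤ C |y n - t|`.
  -- Where `y n = t` the quotient is zero.
  set R : ℕ → X →L[ℝ] X →L[ℝ] ℝ := fun n => (y n - t)⁻¹ • (B (y n) - B t) with hR
  have hquad : ∀ u, ∃ C, ∀ n, |R n u u| ≤ C := fun u => by
    obtain ⟨d, hdu⟩ := hd u t ht
    have h1 := hdu.isBigO_sub.comp_tendsto
      ((tendsto_nhdsWithin_iff.2 ⟨hyt, Eventually.of_forall hyS⟩).prodMk (tendsto_pure.2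
        (Eventually.of_forall fun _ => rfl) : Tendsto (fun _ : ℕ => t) atTop (pure t)))
    obtain ⟨C, hC⟩ := h1.bound
    have h2 : IsBoundedUnder (· ≤ ·) atTop fun n => |R n u u| := by
      refine ⟨|C|, eventually_map.2 (hC.mono fun n hn => ?_)⟩
      simp only [Function.comp_apply, Real.norm_eq_abs] at hn
      simp only [hR, smul_apply, sub_apply, smul_eq_mul, abs_mul, abs_inv]
      rcases eq_or_ne (y n - t) 0 with h0 | h0
      · simp [h0]
      · rw [inv_mul_le_iff₀ (abs_pos.2 h0), mul_comm]
        exact hn.trans (mul_le_mul_of_nonneg_right (le_abs_self C) (abs_nonneg _))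
    obtain ⟨C', hC'⟩ := h2.bddAbove_range
    exact ⟨C', fun n => hC' (mem_range_self n)⟩
  have hpoint : ∀ u v, ∃ C, ∀ n, ‖R n u v‖ ≤ C := fun u v => by
    obtain ⟨C₁, h₁⟩ := hquad (u + v)
    obtain ⟨C₂, h₂⟩ := hquad u
    obtain ⟨C₃, h₃⟩ := hquad v
    refine ⟨(C₁ + C₂ + C₃) / 2, fun n => ?_⟩
    have hs : R n v u = R n u v := by
      simp only [hR, smul_apply, sub_apply, hsymm _ (hyS n) v u, hsymm t ht v u]
    have h4 : R n u v = (R n (u + v) (u + v) - R n u u - R n v v) / 2 := by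
      simp only [map_add, add_apply, hs]; ring
    have a1 := abs_le.1 (h₁ n)
    have a2 := abs_le.1 (h₂ n)
    have a3 := abs_le.1 (h₃ n)
    rw [h4, Real.norm_eq_abs, abs_le]
    constructor <;> linarith [a1.1, a1.2, a2.1, a2.2, a3.1, a3.2]
  obtain ⟨C, hC⟩ := banach_steinhaus fun u => banach_steinhaus (hpoint u)
  refine (tendsto_iff_norm_sub_tendsto_zero (b := B t)).2 ?_
  have hlim : Tendsto (fun n => |y n - t| * C) atTop (𝓝 0) := by
    simpa using (hyt.sub_const t).abs.mul_const C
  refine squeeze_zero (fun n => norm_nonneg (B (y n) - B t)) (fun n => ?_) hlim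
  have hC0 : 0 ≤ C := (norm_nonneg (R n)).trans (hC n)
  refine (B (y n) - B t).opNorm_le_bound₂ (by positivity) fun u v => ?_
  rcases eq_or_ne (y n - t) 0 with h0 | h0
  · rw [sub_eq_zero.1 h0]
    simp
  · have h1 : (B (y n) - B t) u v = (y n - t) * R n u v := by
      simp only [hR, smul_apply, smul_eq_mul, mul_inv_cancel_left₀ h0]
    have h2 : ‖R n u v‖ ≤ C * ‖u‖ * ‖v‖ := ((R n).le_opNorm₂ u v).trans (by gcongr; exact hC n)
    rw [h1, norm_mul, Real.norm_eq_abs (y n - t), mul_assoc, mul_assoc, ← mul_assoc C]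
    exact mul_le_mul_of_nonneg_left h2 (abs_nonneg _)

/-- Gronwall: a function with derivative at most `2 c q` grows at most exponentially. -/
lemma form_growth {q q' : ℝ → ℝ} {c T s t : ℝ}
    (hq : ∀ r ∈ Icc 0 T, HasDerivWithinAt q (q' r) (Icc 0 T) r)
    (hq' : ∀ r ∈ Icc 0 T, q' r ≤ 2 * c * q r) (hs : s ∈ Icc 0 T) (ht : t ∈ Icc 0 T)
    (hst : s ≤ t) : q t ≤ Real.exp (2 * c * (t - s)) * q s := by
  have hd : ∀ r ∈ Icc 0 T, HasDerivWithinAt (fun r => Real.exp (-(2 * c) * r) * q r)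
      (Real.exp (-(2 * c) * r) * (-(2 * c)) * q r + Real.exp (-(2 * c) * r) * q' r)
      (Icc 0 T) r := fun r hr => by
    have := ((hasDerivAt_id r).const_mul (-(2 * c))).exp.hasDerivWithinAt (s := Icc 0 T)
    exact (this.mul (hq r hr)).congr_deriv (by simp)
  have hanti : AntitoneOn (fun r => Real.exp (-(2 * c) * r) * q r) (Icc 0 T) :=
    antitoneOn_of_hasDerivWithinAt_nonpos (convex_Icc 0 T)
      (fun r hr => (hd r hr).continuousWithinAt)
      (fun r hr => (hd r (interior_subset hr)).mono interior_subset) fun r hr => by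
        have := mul_le_mul_of_nonneg_left (hq' r (interior_subset hr))
          (Real.exp_nonneg (-(2 * c) * r))
        linarith
  have h1 := mul_le_mul_of_nonneg_left (hanti hs ht hst) (Real.exp_nonneg (2 * c * t))
  simp only [← mul_assoc, ← Real.exp_add] at h1
  rw [show 2 * c * t + -(2 * c) * t = 0 by ring, Real.exp_zero, one_mul,
    show 2 * c * t + -(2 * c) * s = 2 * c * (t - s) by ring] at h1
  exact h1

end Regularity

theorem mainTheorem4 {𝕜 X : Type*} [RCLike 𝕜] [NormedAddCommGroup X] [InnerProductSpace 𝕜 X]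
    [CompleteSpace X] [NormedSpace ℝ X] [IsScalarTower ℝ 𝕜 X]
    (T : ℝ) (hT : 0 < T)
    -- the inner products `(·,·)_t`, each inducing the topology of `X`
    (I : ℝ → InnerProductSpace.Core 𝕜 X)
    (hI : ∀ t ∈ Set.Icc 0 T, IsEquivalentIP (I t))
    -- `d/dt (u,u)_t` exists and is at most `2c (u,u)_t`
    (c : ℝ) (hc : 0 < c)
    (hdI : ∀ u : X, ∀ t ∈ Set.Icc 0 T, ∃ d : ℝ,
      HasDerivWithinAt (fun s => RCLike.re ((I s).inner u u)) d (Set.Icc 0 T) t ∧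
        d ≤ 2 * c * RCLike.re ((I t).inner u u))
    -- the operators `A(t)`, with domain `D`
    (D : Set X) (A : ℝ → X → X)
    (ω : ℝ) (hω : 0 ≤ ω)
    (hA : ∀ t ∈ Set.Icc 0 T, IsMaximalQuasiMonotone (I t) ω D (A t))
    (L : ℝ) (hL : 0 < L)
    (hLip : ∀ u ∈ D, ∀ s ∈ Set.Icc 0 T, ∀ t ∈ Set.Icc 0 T,
      ipNorm (I 0) (A t u - A s u) ≤
        L * |t - s| * (1 + ipNorm (I 0) u + ipNorm (I 0) (A s u)))
    (a : X) (ha : a ∈ D) :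
    ∃ u : ℝ → X, IsCauchySolution T D A a u ∧
      (∃ K, LipschitzOnWith K u (Set.Icc 0 T)) ∧
      (∃ N : Set ℝ, N.Countable ∧ ∀ t ∈ Set.Icc 0 T \ N,
        HasDerivWithinAt u (-(A t (u t))) (Set.Icc 0 T) t ∧
          ContinuousWithinAt (fun s => -(A s (u s))) (Set.Icc 0 T) t) ∧
      ∀ v : ℝ → X, IsCauchySolution T D A a v → Set.EqOn v u (Set.Icc 0 T) := by
  have h0 : (0 : ℝ) ∈ Icc 0 T := ⟨le_rfl, hT.le⟩
  have hTT : T ∈ Icc 0 T := ⟨hT.le, le_rfl⟩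
  choose! B hB using fun t (ht : t ∈ Icc 0 T) => exists_form (hI t ht)
  have hip : ∀ t ∈ Icc 0 T, ∀ u, ipNorm (I t) u = formNorm (B t) u := fun t ht u => by
    rw [ipNorm, formNorm, hB t ht]
  have hsymm : ∀ t ∈ Icc 0 T, ∀ u v, B t u v = B t v u := fun t ht u v => by
    rw [hB t ht, hB t ht, ← (I t).conj_inner_symm, RCLike.conj_re]
  have hnonneg : ∀ t ∈ Icc 0 T, ∀ u, 0 ≤ B t u u := fun t ht u => by
    rw [hB t ht]; exact (I t).re_inner_nonneg u
  have hdB : ∀ u, ∀ t ∈ Icc 0 T, ∃ d, HasDerivWithinAt (fun s => B s u u) d (Icc 0 T) t ∧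
      d ≤ 2 * c * B t u u := fun u t ht => by
    obtain ⟨d, hd, hle⟩ := hdI u t ht
    exact ⟨d, hd.congr (fun s hs => hB s hs u u) (hB t ht u u), by rwa [hB t ht]⟩
  have hgrowth : ∀ s ∈ Icc 0 T, ∀ t ∈ Icc 0 T, s ≤ t → ∀ u,
      B t u u ≤ Real.exp (2 * c * (t - s)) * B s u u := fun s hs t ht hst u => by
    choose! d hd hle using hdB u
    exact form_growth hd hle hs ht hst
  have hgrowth' : ∀ s ∈ Icc 0 T, ∀ t ∈ Icc 0 T, s ≤ t → ∀ u,
      formNorm (B t) u ≤ Real.exp (c * T) * formNorm (B s) u := fun s hs t ht hst u => by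
    have h1 : Real.exp (2 * c * (t - s)) ≤ Real.exp (c * T) ^ 2 := by
      rw [← Real.exp_nat_mul, Real.exp_le_exp]
      push_cast
      nlinarith [hs.1, ht.2]
    have h2 := Real.sqrt_le_sqrt ((hgrowth s hs t ht hst u).trans
      (mul_le_mul_of_nonneg_right h1 (hnonneg s hs u)))
    rwa [Real.sqrt_mul (sq_nonneg _), Real.sqrt_sq (Real.exp_nonneg _)] at h2
  obtain ⟨m, _, hm, hmT⟩ := hI T hTT
  obtain ⟨_, M, _, hM0⟩ := hI 0 h0
  -- The equivalence constants may vary with `t`, and growth is controlled forwards only: the lower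
  -- bound is carried back from time `T`, the upper one forward from time `0`.
  set κ := Real.exp (c * T) * (1 / m + |M|) with hκ
  have he := Real.exp_pos (c * T)
  have hκ0 : 0 < κ := by positivity
  have hcoercive : ∀ t ∈ Icc 0 T, IsCoerciveForm κ (B t) := fun t ht => by
    refine ⟨hκ0, hsymm t ht, hnonneg t ht, fun u => ?_, fun u => ?_⟩
    · have h1 := (hmT u).1
      rw [hip T hTT] at h1
      have h2 := h1.trans (hgrowth' t ht T hTT ht.2 u)
      rw [← le_div_iff₀' hm] at h2
      refine h2.trans ?_
      rw [hκ, mul_add, add_mul, mul_one_div, mul_div_right_comm]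
      have := formNorm_nonneg (B t) u
      exact le_add_of_nonneg_right (by positivity)
    · have h1 := (hM0 u).2
      rw [hip 0 h0] at h1
      refine (hgrowth' 0 h0 t ht ht.1 u).trans ?_
      rw [hκ, mul_assoc]
      refine mul_le_mul_of_nonneg_left (h1.trans ?_) he.le
      refine mul_le_mul_of_nonneg_right ((le_abs_self M).trans ?_) (norm_nonneg u)
      exact le_add_of_nonneg_left (by positivity)
  have hswap : ∀ s ∈ Icc 0 T, ∀ t ∈ Icc 0 T, ∀ u,
      formNorm (B s) u ≤ κ ^ 2 * formNorm (B t) u := fun s hs t ht u => by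
    rw [sq, mul_assoc]
    exact ((hcoercive s hs).le_norm u).trans
      (mul_le_mul_of_nonneg_left ((hcoercive t ht).norm_le u) hκ0.le)
  -- In the Lipschitz constant, `κ ^ 2` passes from the norm at `0` to the one at `r`, and `1 + κ ^
  -- 2` bounds the size measured at `0` by the state size at `s`.
  have hfam : IsEvolutionFamily T c ω κ (κ ^ 2 * (L * (1 + κ ^ 2))) B D A := by
    refine ⟨hc.le, hω, by positivity, hcoercive, hgrowth,
      continuousOn_form_of_hasDerivWithinAt hsymm
        fun u t ht => (hdB u t ht).imp fun d hd => hd.1,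
      fun t ht => isMaxMonotone_of_isMaximalQuasiMonotone (hB t ht) (hA t ht),
      fun r hr s hs t ht u hu => ?_⟩
    have h1 := hLip u hu s hs t ht
    simp only [hip 0 h0] at h1
    have h2 : 1 + formNorm (B 0) u + formNorm (B 0) (A s u) ≤
        (1 + κ ^ 2) * stateSize B A s u := by
      have h3 := hswap 0 h0 s hs u
      have h4 := hswap 0 h0 s hs (A s u)
      have h5 := formNorm_nonneg (B s) u
      have h6 := formNorm_nonneg (B s) (A s u)
      have h7 := sq_nonneg κ
      unfold stateSize
      linarith
    calc formNorm (B r) (A t u - A s u)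
        ≤ κ ^ 2 * formNorm (B 0) (A t u - A s u) := hswap r hr 0 h0 _
      _ ≤ κ ^ 2 * (L * |t - s| * ((1 + κ ^ 2) * stateSize B A s u)) := by
          gcongr
          exact h1.trans (mul_le_mul_of_nonneg_left h2 (by positivity))
      _ = κ ^ 2 * (L * (1 + κ ^ 2)) * |t - s| * stateSize B A s u := by ring
  obtain ⟨u, hu0, huD, hlip, N, hN, hNu⟩ := hfam.exists_solution hT.le ha
  have hsol : IsCauchySolution T D A a u :=
    ⟨hlip.elim fun K hK => hK.continuousOn, hu0, huD, N, hN, fun t ht => (hNu t ht).1⟩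
  exact ⟨u, hsol, hlip, ⟨N, hN, hNu⟩, fun v hv => hfam.solution_unique hsol hv⟩
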